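/- Let $d\ge 1$ and $n\ge 3$ be integers, and let $G(d,1,n)$ be the group with generators $s_1,\dots,s_n$ and defining relations $s_n^d=1$; $s_i^2=1$ for $1\le i\le n-1$; $s_is_j=s_js_i$ for $j+1<i\le n$; $s_{i+1}s_is_{i+1}=s_is_{i+1}s_i$ for $1\le i\le n-2$; and $s_ns_{n-1}s_ns_{n-1}=s_{n-1}s_ns_{n-1}s_n$. A reduced word of $w\in G(d,1,n)$ is a word of minimal length in the letters $s_1,\dots,s_n$ (without inverses) that expresses $w$. The element $w$ is called fully commutative if its reduced words form a single commutativity class, that is, an equivalence class of words under the equivalence relation generated by replacing a factor $s_is_j$ with $j+1<i$ by $s_js_i$. Write $s_{ij}$ for the word $s_is_{i-1}\cdots s_j$ (empty if $i<j$) and $s_{nj}^{(t)}$ for the word $s_n^{t}s_{n-1,j}$ $(t\ge1)$. A canonical word is a word $\boldsymbol w_0\boldsymbol w'$ with prefix $\boldsymbol w_0=s_{1i_1}s_{2i_2}\cdots s_{n-1,i_{n-1}}$, where $1\le i_p\le p+1$ for $1\le p\le n-1$, and suffix $\boldsymbol w'=s_{nj_1}^{(t_1)}\cdots s_{nj_\ell}^{(t_\ell)}$,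 where $\ell\ge0$, $1\le j_1<\dots<j_\ell\le n$ and $1\le t_p\le d-1$ for $1\le p\le \ell$. The collection labeled by a suffix $\boldsymbol w'$ is the set of all canonical words with suffix $\boldsymbol w'$ that express fully commutative elements of $G(d,1,n)$. For $0\le k\le n$ the packet $\mathcal P(n,k)$ is the set of the collections labeled by the following suffixes (where always $1\le t,t_1,\dots,t_\ell\le d-1$): - $k=n$: the empty suffix; - $k=n-1$: the suffixes $s_n^{t}$ and $s_{n,n-1}^{(t)}$; - $1\le k\le n-2$: the suffixes $s_{nk}^{(t)}$, and all suffixes $s_{n,k+1}^{(t_1)}s_{nj_2}^{(t_2)}\cdots s_{nj_\ell}^{(t_\ell)}$ with $\ell\ge2$ and $k+1<j_2<\dots<j_\ell\le n$; - $k=0$: all suffixes $s_{n1}^{(t_1)}s_{nj_2}^{(t_2)}\cdots s_{nj_\ell}^{(t_\ell)}$ with $\ell\ge2$ and $1<j_2<\dots<j_\ell\le n$. Theorem. For all $0\le k\le n$, every collection in the packet $\mathcal P(n,k)$ has exactly $$C(n,k)=\frac{(n+k)!\,(n-k+1)}{k!\,(n+1)!}$$ elements. -/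

import Mathlib

open scoped Nat

/-- A word in the alphabet `{1, …, n}`. The element `i : Fin n` stands for the letter `i + 1`
(see `letter`), that is, for the generator `s_{i+1}`. -/
abbrev GWord (n : ℕ) : Type := List (Fin n)

/-- The letter in `{1, …, n}` named by an element of `Fin n`. -/
def letter {n : ℕ} (i : Fin n) : ℕ := i.val + 1

/-- The defining relators of `G(d,1,n)`; a relation `u = v` is written as the relator `u * v⁻¹`. -/
inductive IsRelator (d n : ℕ) : FreeGroup (Fin n) → Prop
  /-- `s_n ^ d = 1`. -/
  | order_last (i : Fin n) (hi : letter i = n) : IsRelator d n (FreeGroup.of i ^ d)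
  /-- `s_i ^ 2 = 1` for `i ≤ n - 1`. -/
  | order_two (i : Fin n) (hi : letter i < n) : IsRelator d n (FreeGroup.of i ^ 2)
  /-- `s_i s_j = s_j s_i` for `j + 1 < i`. -/
  | comm (i j : Fin n) (hij : letter j + 1 < letter i) :
      IsRelator d n ((FreeGroup.of i * FreeGroup.of j) * (FreeGroup.of j * FreeGroup.of i)⁻¹)
  /-- `s_j s_i s_j = s_i s_j s_i` for `j = i + 1 ≤ n - 1`. -/
  | braid (i j : Fin n) (hij : letter j = letter i + 1) (hj : letter j < n) :
      IsRelator d n ((FreeGroup.of j * FreeGroup.of i * FreeGroup.of j) *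
        (FreeGroup.of i * FreeGroup.of j * FreeGroup.of i)⁻¹)
  /-- `s_j s_i s_j s_i = s_i s_j s_i s_j` for `j = n` and `i = n - 1`. -/
  | braid_last (i j : Fin n) (hij : letter j = letter i + 1) (hj : letter j = n) :
      IsRelator d n
        ((FreeGroup.of j * FreeGroup.of i * FreeGroup.of j * FreeGroup.of i) *
          (FreeGroup.of i * FreeGroup.of j * FreeGroup.of i * FreeGroup.of j)⁻¹)

/-- The complex reflection group `G(d,1,n)`, by its standard presentation. -/
abbrev GGroup (d n : ℕ) : Type := PresentedGroup {r : FreeGroup (Fin n) | IsRelator d n r}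

/-- The element of `G(d,1,n)` expressed by a word. -/
def evalWord (d n : ℕ) (u : GWord n) : GGroup d n :=
  (u.map fun i => (PresentedGroup.of i : GGroup d n)).prod

/-- The set `R(w)` of reduced expressions: the words of minimal length that express `w`. -/
def reducedWords {d n : ℕ} (w : GGroup d n) : Set (GWord n) :=
  {u | evalWord d n u = w ∧ ∀ v : GWord n, evalWord d n v = w → u.length ≤ v.length}

/-- One application of a commutation `s_i s_j → s_j s_i`, `j + 1 < i`, inside a word. -/
inductive CommStep {n : ℕ} : GWord n → GWord n → Prop
  | swap (a b : GWord n) (i j : Fin n) (hij : letter j + 1 < letter i) :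
      CommStep (a ++ [i, j] ++ b) (a ++ [j, i] ++ b)

/-- The commutativity class of a word `u`: all words obtained from `u` by applying commutations
finitely often, in either direction. -/
def commClass {n : ℕ} (u : GWord n) : Set (GWord n) := {v | Relation.EqvGen CommStep u v}

/-- `w` is fully commutative: `R(w)` consists of a single commutativity class. -/
def IsFullyCommutative {d n : ℕ} (w : GGroup d n) : Prop :=
  ∃ u : GWord n, reducedWords w = commClass u

/-- The word `s_{ij} = [i, i-1, …, j]` (empty if `i < j`). -/
def descWord (n i j : ℕ) : GWord n :=
  (List.finRange n).reverse.filter fun m => j ≤ letter m ∧ letter m ≤ i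

/-- The word `s_{nj}^{(k)} = s_n ^ k s_{n-1,j} = [n, …, n, n-1, …, j]` with `n` occurring `k`
times. -/
def blockWord (n k j : ℕ) : GWord n :=
  (List.replicate k (descWord n n n)).flatten ++ descWord n (n - 1) j

/-- The words `s_{1 i_1} s_{2 i_2} ⋯ s_{n-1, i_{n-1}}` with `1 ≤ i_p ≤ p + 1`
for `1 ≤ p ≤ n - 1`. -/
def prefixes (n : ℕ) : Set (GWord n) :=
  {u | ∃ i : ℕ → ℕ, (∀ p, 1 ≤ p → p ≤ n - 1 → 1 ≤ i p ∧ i p ≤ p + 1) ∧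
    u = ((List.range' 1 (n - 1)).map fun p => descWord n p (i p)).flatten}

/-- Admissible data `(k_1, j_1), …, (k_ℓ, j_ℓ)` of a suffix: `1 ≤ k_p ≤ d - 1` for all `p`, and
`1 ≤ j_1 < ⋯ < j_ℓ ≤ n`. -/
def IsSuffixData (d n : ℕ) (L : List (ℕ × ℕ)) : Prop :=
  L.Pairwise (fun p q => p.2 < q.2) ∧ ∀ p ∈ L, 1 ≤ p.1 ∧ p.1 < d ∧ 1 ≤ p.2 ∧ p.2 ≤ n

/-- The word `s_{n j_1}^{(k_1)} ⋯ s_{n j_ℓ}^{(k_ℓ)}` of the data `(k_1, j_1), …, (k_ℓ, j_ℓ)`. -/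
def suffixWord (n : ℕ) (L : List (ℕ × ℕ)) : GWord n :=
  (L.map fun p => blockWord n p.1 p.2).flatten

/-- The set of all suffixes. -/
def suffixes (d n : ℕ) : Set (GWord n) := {v | ∃ L, IsSuffixData d n L ∧ v = suffixWord n L}

/-- The set of canonical words for `G(d,1,n)`: a prefix followed by a suffix. -/
def canonicalWords (d n : ℕ) : Set (GWord n) :=
  {w | ∃ u ∈ prefixes n, ∃ v ∈ suffixes d n, w = u ++ v}

/-- The collection labeled by the suffix `v`: all canonical words with suffix `v` that express
a fully commutative element. (The factorization of a canonical word is unique: the letter `n` does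
not occur in a prefix, and a nonempty suffix starts with `n`.) -/
def collection (d n : ℕ) (v : GWord n) : Set (GWord n) :=
  {w ∈ canonicalWords d n | (∃ u ∈ prefixes n, w = u ++ v) ∧ IsFullyCommutative (evalWord d n w)}

/-- The suffixes that label the collections of the `(n,k)`-packet. -/
def packetLabels (d n k : ℕ) : Set (GWord n) :=
  {v | (k = n ∧ v = []) ∨
    (k + 1 = n ∧ ∃ t, 1 ≤ t ∧ t < d ∧ (v = blockWord n t n ∨ v = blockWord n t (n - 1))) ∨
    (1 ≤ k ∧ k + 2 ≤ n ∧ ∃ t, 1 ≤ t ∧ t < d ∧ v = blockWord n t k) ∨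
    (k + 2 ≤ n ∧ ∃ t : ℕ, ∃ L : List (ℕ × ℕ), L ≠ [] ∧ IsSuffixData d n ((t, k + 1) :: L) ∧
      v = suffixWord n ((t, k + 1) :: L))}

/-- The `(n,k)`-packet `P(n,k)` of `G(d,1,n)`, a set of collections. -/
def packet (d n k : ℕ) : Set (Set (GWord n)) := collection d n '' packetLabels d n k

/-- The Catalan triangle number `C(n,k) = (n+k)! (n-k+1) / (k! (n+1)!)`, for `0 ≤ k ≤ n`. -/
def catalanTriangle (n k : ℕ) : ℚ :=
  ((n + k)! * ((n : ℚ) - k + 1)) / (k ! * (n + 1)!)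

/-! ### The action of the group on configurations -/

/-- A configuration: position `p` carries a value and a color. -/
abbrev Config (d : ℕ) : Type := ℕ → ℕ × ZMod d

/-- The action of a generator on configurations: `s_{i+1}` exchanges the entries at the positions
`i` and `i + 1`, except that `s_n` raises the color of the last entry. -/
def stepPerm (d n : ℕ) (i : Fin n) : Equiv.Perm (Config d) :=
  if i.val + 1 < n then (Equiv.swap i.val (i.val + 1)).arrowCongr (Equiv.refl _)
  else
    { toFun := fun a => Function.update a i.val ((a i.val).1, (a i.val).2 + 1)
      invFun := fun a => Function.update a i.val ((a i.val).1, (a i.val).2 - 1)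
      left_inv := fun a => by ext p <;> by_cases h : p = i.val <;> simp [h]
      right_inv := fun a => by
        ext p <;> by_cases h : p = i.val <;> simp [h] }

theorem stepPerm_of_lt {d n : ℕ} {i : Fin n} (h : i.val + 1 < n) (a : Config d) :
    stepPerm d n i a = a ∘ Equiv.swap i.val (i.val + 1) := by
  simp [stepPerm, h, Equiv.arrowCongr, Function.comp_def]

theorem stepPerm_symm_of_lt {d n : ℕ} {i : Fin n} (h : i.val + 1 < n) (a : Config d) :
    (stepPerm d n i).symm a = a ∘ Equiv.swap i.val (i.val + 1) := by
  simp [stepPerm, h, Equiv.arrowCongr, Function.comp_def]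

theorem stepPerm_of_last {d n : ℕ} {i : Fin n} (h : i.val + 1 = n) (a : Config d) :
    stepPerm d n i a = Function.update a i.val ((a i.val).1, (a i.val).2 + 1) := by
  simp [stepPerm, h]

theorem stepPerm_symm_of_last {d n : ℕ} {i : Fin n} (h : i.val + 1 = n) (a : Config d) :
    (stepPerm d n i).symm a = Function.update a i.val ((a i.val).1, (a i.val).2 - 1) := by
  simp [stepPerm, h]

theorem stepPerm_last_pow {d n : ℕ} {i : Fin n} (h : i.val + 1 = n) (t : ℕ) (a : Config d) :
    (stepPerm d n i ^ t) a = Function.update a i.val ((a i.val).1, (a i.val).2 + t) := by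
  induction t with
  | zero => simp
  | succ t ih =>
    rw [pow_succ', Equiv.Perm.mul_apply, ih, stepPerm_of_last h]
    simp [add_assoc]

theorem stepPerm_comm {d n : ℕ} {i j : Fin n} (hij : j.val + 1 < i.val) :
    stepPerm d n i * stepPerm d n j = stepPerm d n j * stepPerm d n i := by
  have hj : j.val + 1 < n := by omega
  ext1 a
  simp only [Equiv.Perm.mul_apply]
  by_cases hi : i.val + 1 < n
  · rw [stepPerm_of_lt hi, stepPerm_of_lt hj, stepPerm_of_lt hj, stepPerm_of_lt hi]
    funext p
    simp only [Function.comp_apply, Equiv.swap_apply_def]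
    congr 1
    grind
  · have hi : i.val + 1 = n := by omega
    rw [stepPerm_of_last hi, stepPerm_of_lt hj, stepPerm_of_lt hj, stepPerm_of_last hi]
    funext p
    simp only [Function.comp_apply, Equiv.swap_apply_def, Function.update_apply]
    grind

theorem stepPerm_braid {d n : ℕ} {i j : Fin n} (hij : j.val = i.val + 1) (hj : j.val + 1 < n) :
    stepPerm d n j * stepPerm d n i * stepPerm d n j =
      stepPerm d n i * stepPerm d n j * stepPerm d n i := by
  have hi : i.val + 1 < n := by omega
  ext1 a
  simp only [Equiv.Perm.mul_apply]
  simp only [stepPerm_of_lt hi, stepPerm_of_lt hj]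
  funext p
  simp only [Function.comp_apply, Equiv.swap_apply_def]
  congr 1
  grind

/-- Both sides raise the colors of the last two entries by one and leave every entry in its place.
-/
theorem stepPerm_braid_last {d n : ℕ} {i j : Fin n} (hij : j.val = i.val + 1)
    (hj : j.val + 1 = n) :
    stepPerm d n j * stepPerm d n i * stepPerm d n j * stepPerm d n i =
      stepPerm d n i * stepPerm d n j * stepPerm d n i * stepPerm d n j := by
  have hi : i.val + 1 < n := by omega
  ext1 a
  simp only [Equiv.Perm.mul_apply]
  simp only [stepPerm_of_lt hi, stepPerm_of_last hj]
  funext p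
  simp only [Function.comp_apply, Equiv.swap_apply_def, Function.update_apply]
  grind

/-- The right action of `G(d,1,n)` on configurations. -/
def configHom (d n : ℕ) : GGroup d n →* (Equiv.Perm (Config d))ᵐᵒᵖ :=
  -- The opposite group accounts for reading words from left to right.
  PresentedGroup.toGroup (f := fun i => MulOpposite.op (stepPerm d n i)) (by
    rintro r (⟨i, hi⟩ | ⟨i, hi⟩ | ⟨i, j, hij⟩ | ⟨i, j, hij, hj⟩ | ⟨i, j, hij, hj⟩) <;>
      simp only [letter] at * <;>
      simp only [map_mul, map_pow, map_inv, FreeGroup.lift_apply_of, mul_inv_eq_one] <;>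
      apply MulOpposite.unop_injective <;> simp only [MulOpposite.unop_mul, MulOpposite.unop_pow,
        MulOpposite.unop_op, MulOpposite.unop_one]
    · ext1 a
      rw [stepPerm_last_pow hi]
      simp
    · ext1 a
      rw [pow_two, Equiv.Perm.mul_apply, stepPerm_of_lt hi, stepPerm_of_lt hi]
      funext p
      simp
    · exact (stepPerm_comm (by omega)).symm
    · have := stepPerm_braid (d := d) (n := n) (i := i) (j := j) (by omega) (by omega)
      simpa [mul_assoc] using this
    · have := stepPerm_braid_last (d := d) (n := n) (i := i) (j := j) (by omega) (by omega)
      simpa [mul_assoc] using this.symm)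

/-- The configuration reached from `a` by reading a word. -/
def run {d n : ℕ} (u : GWord n) (a : Config d) : Config d := u.foldl (fun b i => stepPerm d n i b) a

/-- The identity configuration. -/
def initConfig (d : ℕ) : Config d := fun p => (p, 0)

@[simp] theorem run_nil {d n : ℕ} (a : Config d) : run ([] : GWord n) a = a := rfl

@[simp] theorem run_cons {d n : ℕ} (i : Fin n) (u : GWord n) (a : Config d) :
    run (i :: u) a = run u (stepPerm d n i a) := rfl

theorem run_append {d n : ℕ} (u v : GWord n) (a : Config d) : run (u ++ v) a = run v (run u a) :=
  List.foldl_append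

theorem run_eq_configHom {d n : ℕ} (u : GWord n) (a : Config d) :
    run u a = (configHom d n (evalWord d n u)).unop a := by
  induction u generalizing a with
  | nil => simp [evalWord]
  | cons i u ih =>
    rw [run_cons, ih]
    simp [evalWord, configHom]

theorem run_eq_of_evalWord_eq {d n : ℕ} {u v : GWord n} (h : evalWord d n u = evalWord d n v)
    (a : Config d) : run u a = run v a := by
  rw [run_eq_configHom, run_eq_configHom, h]

/-! ### The length function -/

/-- The order of entries: uncolored entries by increasing value, followed by the colored ones by
decreasing value. -/
def EntryGT {d : ℕ} (x y : ℕ × ZMod d) : Prop :=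
  (x.2 ≠ 0 ∧ y.2 = 0) ∨ (x.2 = 0 ∧ y.2 = 0 ∧ y.1 < x.1) ∨ (x.2 ≠ 0 ∧ y.2 ≠ 0 ∧ x.1 < y.1)

/-- The contribution of a pair of entries to the length. -/
def pairCost {d : ℕ} (x y : ℕ × ZMod d) : ℕ :=
  if x.2 = 0 then (if y.1 < x.1 then 1 else 0) else 1 + (if x.1 < y.1 then 1 else 0)

/-- The three cases of the order compare `1 + [x < y]` with `[x < y]`, `1` with `0`, and `2` with
`1`, where `x` and `y` stand for the values. Hence sorting two neighbours saves exactly one. -/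
theorem pairCost_of_gt {d : ℕ} {x y : ℕ × ZMod d} (h : EntryGT x y) :
    pairCost x y = pairCost y x + 1 := by
  unfold EntryGT at h
  unfold pairCost
  grind

theorem EntryGT.asymm {d : ℕ} {x y : ℕ × ZMod d} (h : EntryGT x y) : ¬ EntryGT y x := by
  unfold EntryGT at *
  grind

theorem entryGT_total {d : ℕ} {x y : ℕ × ZMod d} (h : x.1 ≠ y.1) : EntryGT x y ∨ EntryGT y x := by
  unfold EntryGT at *
  grind

/-- The index set of the pairs of positions. -/
def pairs (n : ℕ) : Finset (ℕ × ℕ) :=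
  (Finset.range n ×ˢ Finset.range n).filter fun x => x.1 < x.2

theorem mem_pairs {n : ℕ} {x : ℕ × ℕ} : x ∈ pairs n ↔ x.1 < x.2 ∧ x.2 < n := by
  simp only [pairs, Finset.mem_filter, Finset.mem_product, Finset.mem_range]
  omega

/-- The length of a configuration. -/
def cost {d : ℕ} (n : ℕ) (a : Config d) : ℕ :=
  ∑ p ∈ Finset.range n, (a p).2.val + ∑ x ∈ pairs n, pairCost (a x.1) (a x.2)

/-- The exchange permutes the pairs of positions other than `(i, i + 1)` without reversing any of
them, so only the contribution of that one pair changes. -/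
theorem cost_swap {d n i : ℕ} (hi : i + 1 < n) (a : Config d) :
    cost n (a ∘ Equiv.swap i (i + 1)) + pairCost (a i) (a (i + 1)) =
      cost n a + pairCost (a (i + 1)) (a i) := by
  have hsum : ∑ p ∈ Finset.range n, ((a ∘ Equiv.swap i (i + 1)) p).2.val =
      ∑ p ∈ Finset.range n, (a p).2.val := by
    refine Finset.sum_nbij' (Equiv.swap i (i + 1)) (Equiv.swap i (i + 1)) ?_ ?_ ?_ ?_ ?_ <;>
      simp only [Finset.mem_range, Equiv.swap_apply_self, implies_true, Function.comp_apply] <;>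
      intro p hp <;> simp only [Equiv.swap_apply_def] <;> grind
  have hmem : (i, i + 1) ∈ pairs n := by simp [mem_pairs, hi]
  have hpairs : ∑ x ∈ (pairs n).erase (i, i + 1),
        pairCost ((a ∘ Equiv.swap i (i + 1)) x.1) ((a ∘ Equiv.swap i (i + 1)) x.2) =
      ∑ x ∈ (pairs n).erase (i, i + 1), pairCost (a x.1) (a x.2) := by
    refine Finset.sum_nbij' (fun x => (Equiv.swap i (i + 1) x.1, Equiv.swap i (i + 1) x.2))
      (fun x => (Equiv.swap i (i + 1) x.1, Equiv.swap i (i + 1) x.2)) ?_ ?_ ?_ ?_ ?_ <;>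
      simp only [Finset.mem_erase, mem_pairs, Equiv.swap_apply_self, implies_true,
        Function.comp_apply] <;>
      rintro ⟨p, q⟩ <;> simp only [Equiv.swap_apply_def, ne_eq, Prod.mk.injEq] <;> grind
  unfold cost
  rw [hsum, ← Finset.add_sum_erase _ _ hmem, ← Finset.add_sum_erase _ _ hmem, hpairs]
  simp only [Function.comp_apply, Equiv.swap_apply_left, Equiv.swap_apply_right]
  omega

/-- `pairCost` reads only the color of its left entry, and the last position is never on the left of
a pair. -/
theorem cost_update_last {d n i : ℕ} (hi : i + 1 = n) (a : Config d) (c : ZMod d) :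
    cost n (Function.update a i ((a i).1, c)) + (a i).2.val = cost n a + c.val := by
  have hmem : i ∈ Finset.range n := by simp; omega
  have hsum : ∑ p ∈ (Finset.range n).erase i, (Function.update a i ((a i).1, c) p).2.val =
      ∑ p ∈ (Finset.range n).erase i, (a p).2.val := by
    refine Finset.sum_congr rfl fun p hp => ?_
    rw [Function.update_of_ne (Finset.ne_of_mem_erase hp)]
  have hpairs : ∑ x ∈ pairs n, pairCost (Function.update a i ((a i).1, c) x.1)
        (Function.update a i ((a i).1, c) x.2) = ∑ x ∈ pairs n, pairCost (a x.1) (a x.2) := by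
    refine Finset.sum_congr rfl fun x hx => ?_
    rw [mem_pairs] at hx
    have h1 : x.1 ≠ i := by omega
    rw [Function.update_of_ne h1]
    by_cases h2 : x.2 = i
    · simp [h2, pairCost]
    · rw [Function.update_of_ne h2]
  unfold cost
  rw [hpairs, ← Finset.add_sum_erase _ _ hmem, ← Finset.add_sum_erase _ _ hmem, hsum]
  simp only [Function.update_self]
  omega

/-! ### Descents and reachable configurations -/

/-- The generator `i` shortens the configuration. -/
def IsDescent {d n : ℕ} (a : Config d) (i : Fin n) : Prop :=
  if i.val + 1 < n then EntryGT (a i.val) (a (i.val + 1)) else (a i.val).2 ≠ 0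

/-- The configurations that are reached from the identity. -/
structure Valid {d : ℕ} (n : ℕ) (a : Config d) : Prop where
  inj : Function.Injective fun p => (a p).1
  fix : ∀ p, n ≤ p → a p = (p, 0)
  lt : ∀ p, p < n → (a p).1 < n

theorem valid_init (d n : ℕ) : Valid n (initConfig d) :=
  ⟨fun _ _ h => h, fun _ _ => rfl, fun _ h => h⟩

theorem Valid.swap {d n i : ℕ} {a : Config d} (h : Valid n a) (hi : i + 1 < n) :
    Valid n (a ∘ Equiv.swap i (i + 1)) := by
  refine ⟨fun p q hpq => (Equiv.swap i (i + 1)).injective (h.inj hpq), fun p hp => ?_,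
    fun p hp => ?_⟩
  · rw [Function.comp_apply, Equiv.swap_apply_of_ne_of_ne (by omega) (by omega), h.fix p hp]
  · refine h.lt _ ?_
    simp only [Equiv.swap_apply_def]
    grind

theorem Valid.update {d n i : ℕ} {a : Config d} (h : Valid n a) (hi : i + 1 = n) (c : ZMod d) :
    Valid n (Function.update a i ((a i).1, c)) := by
  have key : ∀ p, (Function.update a i ((a i).1, c) p).1 = (a p).1 := by
    intro p
    by_cases hp : p = i <;> simp [hp]
  refine ⟨fun p q hpq => h.inj (by simpa [key] using hpq), fun p hp => ?_, fun p hp => ?_⟩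
  · rw [Function.update_of_ne (by omega), h.fix p hp]
  · rw [key]
    exact h.lt p hp

theorem Valid.step {d n : ℕ} {a : Config d} (h : Valid n a) (i : Fin n) :
    Valid n (stepPerm d n i a) := by
  by_cases hi : i.val + 1 < n
  · rw [stepPerm_of_lt hi]; exact h.swap hi
  · have hi : i.val + 1 = n := by omega
    rw [stepPerm_of_last hi]; exact h.update hi _

theorem Valid.symm {d n : ℕ} {a : Config d} (h : Valid n a) (i : Fin n) :
    Valid n ((stepPerm d n i).symm a) := by
  by_cases hi : i.val + 1 < n
  · rw [stepPerm_symm_of_lt hi]; exact h.swap hi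
  · have hi : i.val + 1 = n := by omega
    rw [stepPerm_symm_of_last hi]; exact h.update hi _

theorem Valid.run {d n : ℕ} {a : Config d} (h : Valid n a) (u : GWord n) : Valid n (run u a) := by
  induction u generalizing a with
  | nil => exact h
  | cons i u ih => exact ih (h.step i)

theorem ZMod.val_sub_one_add_one {d : ℕ} [NeZero d] {c : ZMod d} (hc : c ≠ 0) :
    (c - 1).val + 1 = c.val := by
  have h0 : c.val ≠ 0 := by rwa [Ne, ZMod.val_eq_zero]
  have h1 : c - 1 = ((c.val - 1 : ℕ) : ZMod d) := by
    rw [Nat.cast_sub (by omega)]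
    simp
  have := ZMod.val_lt c
  rw [h1, ZMod.val_natCast, Nat.mod_eq_of_lt (by omega)]
  omega

theorem cost_symm_of_isDescent {d n : ℕ} [NeZero d] {a : Config d} {i : Fin n}
    (h : IsDescent a i) : cost n a = cost n ((stepPerm d n i).symm a) + 1 := by
  unfold IsDescent at h
  split_ifs at h with hi
  · rw [stepPerm_symm_of_lt hi]
    have := cost_swap hi a
    have := pairCost_of_gt h
    omega
  · have hi : i.val + 1 = n := by omega
    rw [stepPerm_symm_of_last hi]
    have := cost_update_last hi a ((a i.val).2 - 1)
    have := ZMod.val_sub_one_add_one h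
    omega

/-- At the last position a zero color wraps around to `d - 1`. The inequality is weak because for `d
= 1` the last generator acts trivially. -/
theorem cost_le_symm {d n : ℕ} [NeZero d] {a : Config d} (ha : Valid n a) {i : Fin n}
    (h : ¬ IsDescent a i) : cost n a ≤ cost n ((stepPerm d n i).symm a) := by
  unfold IsDescent at h
  split_ifs at h with hi
  · rw [stepPerm_symm_of_lt hi]
    have hne : (a i.val).1 ≠ (a (i.val + 1)).1 := fun hh => by
      have := ha.inj hh
      omega
    have := cost_swap hi a
    have := pairCost_of_gt ((entryGT_total hne).resolve_left h)
    omega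
  · have hi : i.val + 1 = n := by omega
    rw [stepPerm_symm_of_last hi]
    have := cost_update_last hi a ((a i.val).2 - 1)
    simp only [not_not] at h
    rw [h, ZMod.val_zero] at this
    rw [h]
    omega

theorem cost_step_le {d n : ℕ} [NeZero d] {a : Config d} (ha : Valid n a) (i : Fin n) :
    cost n (stepPerm d n i a) ≤ cost n a + 1 := by
  by_cases h : IsDescent (stepPerm d n i a) i
  · have := cost_symm_of_isDescent h
    rw [Equiv.symm_apply_apply] at this
    omega
  · have := cost_le_symm (ha.step i) h
    rw [Equiv.symm_apply_apply] at this
    omega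

theorem cost_run_le {d n : ℕ} [NeZero d] {a : Config d} (ha : Valid n a) (u : GWord n) :
    cost n (run u a) ≤ cost n a + u.length := by
  induction u generalizing a with
  | nil => simp
  | cons i u ih =>
    have h1 := ih (ha.step i)
    have h2 := cost_step_le ha i
    simp only [run_cons, List.length_cons]
    omega

theorem cost_init (d n : ℕ) : cost n (initConfig d) = 0 := by
  unfold cost initConfig
  simp only [ZMod.val_zero, Finset.sum_const_zero, zero_add]
  refine Finset.sum_eq_zero fun x hx => ?_
  rw [mem_pairs] at hx
  have : ¬ x.2 < x.1 := by omega
  simp [pairCost, this]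

/-! ### Tight words -/

/-- The configuration of a word. -/
def config (d : ℕ) {n : ℕ} (u : GWord n) : Config d := run u (initConfig d)

theorem valid_config (d : ℕ) {n : ℕ} (u : GWord n) : Valid n (config d u) :=
  (valid_init d n).run u

/-- A word whose length is the length of its configuration. -/
def IsTight (d : ℕ) {n : ℕ} (u : GWord n) : Prop := cost n (config d u) = u.length

theorem cost_config_le (d : ℕ) [NeZero d] {n : ℕ} (u : GWord n) :
    cost n (config d u) ≤ u.length := by
  have := cost_run_le (valid_init d n) u
  rw [cost_init] at this
  simpa [config] using this

/-- Words for the same element have the same configuration, and its cost bounds the length of each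
of them from below. -/
theorem IsTight.mem_reducedWords {d n : ℕ} [NeZero d] {u v : GWord n} (hu : IsTight d u)
    (hv : evalWord d n v = evalWord d n u) (hlen : v.length = u.length) :
    v ∈ reducedWords (evalWord d n u) := by
  refine ⟨hv, fun x hx => ?_⟩
  have h1 := cost_config_le d x
  have h2 : config d x = config d u := run_eq_of_evalWord_eq hx _
  rw [h2, hu] at h1
  omega

theorem IsTight.of_mem_reducedWords {d n : ℕ} [NeZero d] {u v : GWord n} (hu : IsTight d u)
    (hv : v ∈ reducedWords (evalWord d n u)) : config d v = config d u ∧ IsTight d v := by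
  have h2 : config d v = config d u := run_eq_of_evalWord_eq hv.1 _
  refine ⟨h2, ?_⟩
  have h1 := hv.2 u rfl
  have h3 := cost_config_le d v
  rw [h2, hu] at h3
  unfold IsTight
  rw [h2, hu]
  omega

theorem config_concat {d n : ℕ} (u : GWord n) (i : Fin n) :
    config d (u ++ [i]) = stepPerm d n i (config d u) := by
  simp [config, run_append]

/-- One letter adds at most one to the cost, so a tight word gains exactly one at its last letter; a
letter that is not a descent would gain nothing. -/
theorem IsTight.of_concat {d n : ℕ} [NeZero d] {u : GWord n} {i : Fin n}
    (h : IsTight d (u ++ [i])) :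
    IsTight d u ∧ IsDescent (config d (u ++ [i])) i := by
  have h1 := cost_config_le d u
  have h2 := cost_step_le (valid_config d u) i
  rw [← config_concat, h] at h2
  simp only [List.length_append, List.length_singleton] at h2
  refine ⟨by unfold IsTight; omega, ?_⟩
  by_contra h3
  have h4 := cost_le_symm (valid_config d _) h3
  rw [h, config_concat, Equiv.symm_apply_apply] at h4
  simp only [List.length_append, List.length_singleton] at h4
  omega

theorem IsTight.concat {d n : ℕ} [NeZero d] {u : GWord n} {i : Fin n} (h : IsTight d u)
    (hi : IsDescent (config d (u ++ [i])) i) : IsTight d (u ++ [i]) := by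
  have := cost_symm_of_isDescent hi
  unfold IsTight at *
  rw [this, config_concat, Equiv.symm_apply_apply, h]
  simp

/-! ### Commutation classes of words -/

theorem commStep_append_right {n : ℕ} {u v : GWord n} (h : CommStep u v) (w : GWord n) :
    CommStep (u ++ w) (v ++ w) := by
  obtain ⟨a, b, i, j, hij⟩ := h
  simpa using CommStep.swap a (b ++ w) i j hij

theorem commStep_append_left {n : ℕ} {u v : GWord n} (h : CommStep u v) (w : GWord n) :
    CommStep (w ++ u) (w ++ v) := by
  obtain ⟨a, b, i, j, hij⟩ := h
  simpa using CommStep.swap (w ++ a) b i j hij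

theorem commEquiv_append_right {n : ℕ} {u v : GWord n} (h : Relation.EqvGen CommStep u v)
    (w : GWord n) : Relation.EqvGen CommStep (u ++ w) (v ++ w) := by
  induction h with
  | rel _ _ h => exact .rel _ _ (commStep_append_right h w)
  | refl _ => exact .refl _
  | symm _ _ _ ih => exact .symm _ _ ih
  | trans _ _ _ _ _ ih1 ih2 => exact .trans _ _ _ ih1 ih2

theorem commEquiv_append_left {n : ℕ} {u v : GWord n} (h : Relation.EqvGen CommStep u v)
    (w : GWord n) : Relation.EqvGen CommStep (w ++ u) (w ++ v) := by
  induction h with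
  | rel _ _ h => exact .rel _ _ (commStep_append_left h w)
  | refl _ => exact .refl _
  | symm _ _ _ ih => exact .symm _ _ ih
  | trans _ _ _ _ _ ih1 ih2 => exact .trans _ _ _ ih1 ih2

/-- Two letters of a word that may be exchanged. -/
def Commutes {n : ℕ} (i j : Fin n) : Prop := i.val + 1 < j.val ∨ j.val + 1 < i.val

theorem commEquiv_pair {n : ℕ} {i j : Fin n} (h : Commutes i j) :
    Relation.EqvGen CommStep [i, j] [j, i] := by
  rcases h with h | h
  · exact .symm _ _ (.rel _ _ (by simpa using CommStep.swap [] [] j i (by simpa [letter] using h)))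
  · exact .rel _ _ (by simpa using CommStep.swap [] [] i j (by simpa [letter] using h))

theorem commEquiv_concat_pair {n : ℕ} {i j : Fin n} (h : Commutes i j) (u : GWord n) :
    Relation.EqvGen CommStep (u ++ [i] ++ [j]) (u ++ [j] ++ [i]) := by
  simpa using commEquiv_append_left (commEquiv_pair h) u

/-! ### Pattern avoidance and the diamond argument -/

/-- The patterns avoided by the configurations of fully commutative elements. -/
structure AvoidsPatterns {d : ℕ} (n : ℕ) (a : Config d) : Prop where
  no_descending : ∀ p q s, p < q → q < s → s < n → EntryGT (a p) (a q) → ¬ EntryGT (a q) (a s)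
  colored_lt : ∀ p q, p < q → q < n → (a p).2 ≠ 0 → (a q).2 ≠ 0 → (a q).1 < (a p).1
  uncolored_lt : ∀ p q s, p < q → q < n → p < s → s < n → (a p).2 ≠ 0 → (a q).2 ≠ 0 →
    (a s).2 = 0 → (a s).1 < (a q).1
  inverted_lt : ∀ p q s, p < q → q < n → s < n → (a p).2 = 0 → (a q).2 = 0 →
    (a q).1 < (a p).1 → (a s).2 ≠ 0 → ¬ (a s).1 < (a q).1

/-- Sorting the descent at `i` removes one inversion and creates none, so every inversion left comes
from one of `a` with its positions in the same order. -/
theorem swap_lt_swap {d i p q : ℕ} {a : Config d} (hi : EntryGT (a i) (a (i + 1)))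
    (hpq : p < q)
    (h : EntryGT (a (Equiv.swap i (i + 1) p)) (a (Equiv.swap i (i + 1) q))) :
    Equiv.swap i (i + 1) p < Equiv.swap i (i + 1) q := by
  by_cases hp : p = i ∧ q = i + 1
  · obtain ⟨rfl, rfl⟩ := hp
    simp only [Equiv.swap_apply_left, Equiv.swap_apply_right] at h
    exact absurd hi h.asymm
  · simp only [Equiv.swap_apply_def]
    grind

theorem swap_lt_of_lt {i n p : ℕ} (hi : i + 1 < n) (hp : p < n) :
    Equiv.swap i (i + 1) p < n := by
  simp only [Equiv.swap_apply_def]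
  grind

theorem AvoidsPatterns.swap {d n i : ℕ} {a : Config d} (h : AvoidsPatterns n a) (hi : i + 1 < n)
    (hgt : EntryGT (a i) (a (i + 1))) : AvoidsPatterns n (a ∘ Equiv.swap i (i + 1)) := by
  -- Colored values decrease from left to right, whereas a descent between two colored entries needs
  -- an increase; so the exchange never involves two colored entries.
  have hcol : ∀ p q, p < q → q < n → (a (Equiv.swap i (i + 1) p)).2 ≠ 0 →
      (a (Equiv.swap i (i + 1) q)).2 ≠ 0 →
      Equiv.swap i (i + 1) p < Equiv.swap i (i + 1) q := by
    intro p q hpq hq hcp hcq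
    by_cases hp : p = i ∧ q = i + 1
    · obtain ⟨rfl, rfl⟩ := hp
      simp only [Equiv.swap_apply_left, Equiv.swap_apply_right] at hcp hcq
      have := h.colored_lt p (p + 1) hpq hq hcq hcp
      unfold EntryGT at hgt
      grind
    · simp only [Equiv.swap_apply_def]
      grind
  constructor
  · intro p q s hpq hqs hs h1 h2
    exact h.no_descending _ _ _ (swap_lt_swap hgt hpq h1) (swap_lt_swap hgt hqs h2)
      (swap_lt_of_lt hi hs) h1 h2
  · intro p q hpq hq h1 h2
    exact h.colored_lt _ _ (hcol p q hpq hq h1 h2) (swap_lt_of_lt hi hq) h1 h2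
  · intro p q s hpq hq hps hs h1 h2 h3
    exact h.uncolored_lt _ _ _ (hcol p q hpq hq h1 h2) (swap_lt_of_lt hi hq)
      (swap_lt_swap hgt hps (Or.inl ⟨h1, h3⟩)) (swap_lt_of_lt hi hs) h1 h2 h3
  · intro p q s hpq hq hs h1 h2 h3 h4
    exact h.inverted_lt _ _ _ (swap_lt_swap hgt hpq (Or.inr (Or.inl ⟨h1, h2, h3⟩)))
      (swap_lt_of_lt hi hq) (swap_lt_of_lt hi hs) h1 h2 h3 h4

/-- The critical case is that the last entry loses its color and completes a descending triple. The
other three conditions exclude this: `colored_lt` if the middle entry is colored, `uncolored_lt` if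
only the first one is, and `inverted_lt` if neither is. This is what makes the class closed under
removing descents. -/
theorem AvoidsPatterns.update {d n i : ℕ} {a : Config d} (h : AvoidsPatterns n a)
    (hv : Valid n a) (hi : i + 1 = n) (hc : (a i).2 ≠ 0) (c : ZMod d) :
    AvoidsPatterns n (Function.update a i ((a i).1, c)) := by
  have h1 : ∀ p, p ≠ i → Function.update a i ((a i).1, c) p = a p := fun p hp =>
    Function.update_of_ne hp _ _
  have h2 : Function.update a i ((a i).1, c) i = ((a i).1, c) := Function.update_self ..
  have hinj : ∀ p q, p ≠ q → (a p).1 ≠ (a q).1 := fun p q hpq hh => hpq (hv.inj hh)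
  generalize Function.update a i ((a i).1, c) = b at h1 h2
  constructor
  · intro p q s hpq hqs hs g1 g2
    rw [h1 p (by omega), h1 q (by omega)] at g1
    rw [h1 q (by omega)] at g2
    by_cases hsi : s = i
    · subst hsi
      rw [h2] at g2
      have e1 := h.colored_lt p s (by omega) hs
      have e2 := h.colored_lt q s (by omega) hs
      have e3 := h.colored_lt p q (by omega) (by omega)
      have e4 := h.uncolored_lt p s q (by omega) (by omega) hpq (by omega)
      have e5 := h.inverted_lt p q s hpq (by omega) hs
      unfold EntryGT at g1 g2
      grind
    · rw [h1 s hsi] at g2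
      exact h.no_descending p q s hpq hqs hs g1 g2
  · intro p q hpq hq
    rw [h1 p (by omega)]
    have e1 := h.colored_lt p q hpq hq
    by_cases hqi : q = i
    · subst hqi
      rw [h2]
      grind
    · rw [h1 q hqi]
      exact e1
  · intro p q s hpq hq hps hs
    rw [h1 p (by omega)]
    have e1 := h.uncolored_lt p q s hpq hq hps hs
    by_cases hqi : q = i
    · subst hqi
      by_cases hsi : s = q
      · subst hsi
        grind
      · rw [h1 s hsi, h2]
        grind
    · by_cases hsi : s = i
      · subst hsi
        have e2 := h.colored_lt q s (by omega) (by omega)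
        rw [h1 q hqi, h2]
        grind
      · rw [h1 q hqi, h1 s hsi]
        exact e1
  · intro p q s hpq hq hs
    rw [h1 p (by omega)]
    have e1 := h.inverted_lt p q s hpq hq hs
    by_cases hqi : q = i
    · subst hqi
      by_cases hsi : s = q
      · subst hsi
        rw [h2]
        grind
      · have e2 := h.colored_lt s q (by omega) hq
        rw [h1 s hsi, h2]
        grind
    · by_cases hsi : s = i
      · subst hsi
        rw [h1 q hqi, h2]
        grind
      · rw [h1 q hqi, h1 s hsi]
        exact e1

theorem AvoidsPatterns.symm {d n : ℕ} {a : Config d} (h : AvoidsPatterns n a) (hv : Valid n a)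
    {i : Fin n} (hi : IsDescent a i) : AvoidsPatterns n ((stepPerm d n i).symm a) := by
  unfold IsDescent at hi
  split_ifs at hi with hin
  · rw [stepPerm_symm_of_lt hin]
    exact h.swap hin hi
  · have hin : i.val + 1 = n := by omega
    rw [stepPerm_symm_of_last hin]
    exact h.update hv hin hi _

/-- Two neighbouring descents form a descending triple; at the right end, they would put a descent
in front of a colored last entry, against `colored_lt`. -/
theorem AvoidsPatterns.not_isDescent_succ {d n : ℕ} {a : Config d} (h : AvoidsPatterns n a)
    {i j : Fin n} (hij : j.val = i.val + 1) (hi : IsDescent a i) : ¬ IsDescent a j := by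
  have hin : i.val + 1 < n := by omega
  unfold IsDescent at *
  rw [if_pos hin] at hi
  split_ifs with hjn
  · rw [hij] at hjn ⊢
    exact h.no_descending _ _ _ (by omega) (by omega) hjn hi
  · rw [hij]
    intro hc
    have := h.colored_lt i.val (i.val + 1) (by omega) hin
    unfold EntryGT at hi
    grind

theorem AvoidsPatterns.commutes {d n : ℕ} {a : Config d} (h : AvoidsPatterns n a)
    {i j : Fin n} (hij : i ≠ j) (hi : IsDescent a i) (hj : IsDescent a j) : Commutes i j := by
  have h1 : j.val ≠ i.val + 1 := fun e => h.not_isDescent_succ e hi hj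
  have h2 : i.val ≠ j.val + 1 := fun e => h.not_isDescent_succ e hj hi
  have h3 : i.val ≠ j.val := fun e => hij (Fin.ext e)
  unfold Commutes
  omega

theorem IsDescent.symm_of_commutes {d n : ℕ} {a : Config d} {i j : Fin n} (h : Commutes i j)
    (hj : IsDescent a j) : IsDescent ((stepPerm d n i).symm a) j := by
  have key : ∀ p, p ≠ i.val → p ≠ i.val + 1 → (stepPerm d n i).symm a p = a p := by
    intro p h1 h2
    by_cases hi : i.val + 1 < n
    · rw [stepPerm_symm_of_lt hi, Function.comp_apply, Equiv.swap_apply_of_ne_of_ne h1 h2]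
    · rw [stepPerm_symm_of_last (by omega), Function.update_of_ne h1]
  have key' : i.val + 1 = n → ∀ p, p ≠ i.val → (stepPerm d n i).symm a p = a p := by
    intro hi p h1
    rw [stepPerm_symm_of_last (by omega), Function.update_of_ne h1]
  unfold Commutes at h
  unfold IsDescent at *
  rw [key j.val (by omega) (by omega)]
  by_cases hjn : j.val + 1 < n
  · rw [if_pos hjn] at hj ⊢
    by_cases hji : j.val + 1 = i.val
    · omega
    · by_cases hji' : j.val + 1 = i.val + 1
      · omega
      · rwa [key _ hji hji']
  · rw [if_neg hjn] at hj ⊢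
    exact hj

theorem stepPerm_symm_comm {d n : ℕ} {i j : Fin n} (h : Commutes i j) (a : Config d) :
    (stepPerm d n i).symm ((stepPerm d n j).symm a) =
      (stepPerm d n j).symm ((stepPerm d n i).symm a) := by
  have e : stepPerm d n i * stepPerm d n j = stepPerm d n j * stepPerm d n i := by
    rcases h with h | h
    · exact (stepPerm_comm h).symm
    · exact stepPerm_comm h
  rw [Equiv.symm_apply_eq, Equiv.symm_apply_eq]
  have := congrArg (fun f => f ((stepPerm d n j).symm ((stepPerm d n i).symm a))) e
  simpa only [Equiv.Perm.mul_apply, Equiv.apply_symm_apply] using this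

/-- Colors vanish from right to left, since a colored entry before an uncolored one is a descent.
The values then increase, and an increasing map of `{0, …, n - 1}` to itself is the identity. -/
theorem eq_init_of_not_isDescent {d n : ℕ} {a : Config d} (hv : Valid n a)
    (h : ∀ i : Fin n, ¬ IsDescent a i) : a = initConfig d := by
  have hcol : ∀ k p, p + k + 1 = n → (a p).2 = 0 := by
    intro k
    induction k with
    | zero =>
      intro p hp
      have := h ⟨p, by omega⟩
      unfold IsDescent at this
      simpa [show ¬ p + 1 < n by omega] using this
    | succ k ih =>
      intro p hp
      have h1 := ih (p + 1) (by omega)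
      have := h ⟨p, by omega⟩
      unfold IsDescent EntryGT at this
      simp only [show p + 1 < n by omega, if_true] at this
      grind
  have hcol' : ∀ p, p < n → (a p).2 = 0 := fun p hp => hcol (n - 1 - p) p (by omega)
  have hmono : ∀ p, p + 1 < n → (a p).1 < (a (p + 1)).1 := by
    intro p hp
    have h1 := h ⟨p, by omega⟩
    have h2 := hcol' p (by omega)
    have h3 := hcol' (p + 1) hp
    have h4 : (a p).1 ≠ (a (p + 1)).1 := fun hh => by
      have := hv.inj hh
      omega
    unfold IsDescent EntryGT at h1
    simp only [hp, if_true] at h1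
    grind
  have hge : ∀ p, p < n → p ≤ (a p).1 := by
    intro p
    induction p with
    | zero => intro _; omega
    | succ p ih =>
      intro hp
      have := ih (by omega)
      have := hmono p hp
      omega
  have hle : ∀ k p, p + k + 1 = n → (a p).1 ≤ p := by
    intro k
    induction k with
    | zero =>
      intro p hp
      have := hv.lt p (by omega)
      omega
    | succ k ih =>
      intro p hp
      have := ih (p + 1) (by omega)
      have := hmono p (by omega)
      omega
  funext p
  by_cases hp : p < n
  · have h1 := hge p hp
    have h2 := hle (n - 1 - p) p (by omega)
    exact Prod.ext (by simp only [initConfig]; omega) (hcol' p hp)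
  · exact hv.fix p (by omega)

theorem exists_isTight {d n : ℕ} [NeZero d] {a : Config d} (hv : Valid n a) :
    ∃ u : GWord n, config d u = a ∧ IsTight d u := by
  induction hN : cost n a generalizing a with
  | zero =>
    have : ∀ i : Fin n, ¬ IsDescent a i := fun i hi => by
      have := cost_symm_of_isDescent hi
      omega
    have := eq_init_of_not_isDescent hv this
    refine ⟨[], this.symm, ?_⟩
    simp [IsTight, config, cost_init]
  | succ N ih =>
    by_cases h : ∀ i : Fin n, ¬ IsDescent a i
    · rw [eq_init_of_not_isDescent hv h, cost_init] at hN
      omega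
    · push Not at h
      obtain ⟨i, hi⟩ := h
      have := cost_symm_of_isDescent hi
      obtain ⟨u, hu, ht⟩ := ih (hv.symm i) (by omega)
      have hc : config d (u ++ [i]) = a := by rw [config_concat, hu, Equiv.apply_symm_apply]
      exact ⟨u ++ [i], hc, ht.concat (by rwa [hc])⟩

/-- The induction removes the last letters of both words. If these differ, they are commuting
descents, and a tight word for the configuration with both removed closes the diamond. -/
theorem commEquiv_of_avoidsPatterns {d n : ℕ} [NeZero d] {u v : GWord n}
    (hc : config d u = config d v) (hu : IsTight d u) (hv : IsTight d v)
    (h : AvoidsPatterns n (config d u)) : Relation.EqvGen CommStep u v := by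
  induction hN : u.length generalizing u v with
  | zero =>
    have h1 : u = [] := List.eq_nil_of_length_eq_zero hN
    have h2 : v = [] := by
      apply List.eq_nil_of_length_eq_zero
      unfold IsTight at hu hv
      rw [← hv, ← hc, hu, hN]
    rw [h1, h2]
    exact .refl _
  | succ N ih =>
    have hlen : u.length = v.length := by
      unfold IsTight at hu hv
      rw [← hv, ← hc, hu]
    obtain ⟨u', i, rfl⟩ := List.eq_nil_or_concat' u |>.resolve_left (by rintro rfl; simp at hN)
    obtain ⟨v', j, rfl⟩ := List.eq_nil_or_concat' v |>.resolve_left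
      (by rintro rfl; simp at hN hlen)
    obtain ⟨hu', hi⟩ := hu.of_concat
    obtain ⟨hv', hj⟩ := hv.of_concat
    rw [← hc] at hj
    have eu : config d u' = (stepPerm d n i).symm (config d (u' ++ [i])) := by
      rw [config_concat, Equiv.symm_apply_apply]
    have ev : config d v' = (stepPerm d n j).symm (config d (u' ++ [i])) := by
      rw [hc, config_concat, Equiv.symm_apply_apply]
    have hval := valid_config d (u' ++ [i])
    generalize config d (u' ++ [i]) = a at *
    simp only [List.length_append, List.length_singleton] at hN hlen
    by_cases hij : i = j
    · subst hij
      refine commEquiv_append_right (ih (eu.trans ev.symm) hu' hv' ?_ (by omega)) _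
      rw [eu]
      exact h.symm hval hi
    · have hcomm := h.commutes hij hi hj
      have hji := hi.symm_of_commutes (i := j) (j := i) (by unfold Commutes at *; omega)
      have hij' := hj.symm_of_commutes hcomm
      -- The bottom of the diamond: `x` followed by `j` replaces `u'`, and `x` followed by `i`
      -- replaces `v'`.
      obtain ⟨x, hx, hxt⟩ := exists_isTight ((hval.symm j).symm i)
      have cj : config d (x ++ [j]) = config d u' := by
        rw [config_concat, hx, stepPerm_symm_comm hcomm, Equiv.apply_symm_apply, eu]
      have ci : config d (x ++ [i]) = config d v' := by
        rw [config_concat, hx, Equiv.apply_symm_apply, ev]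
      have tj : IsTight d (x ++ [j]) := hxt.concat (by rw [cj, eu]; exact hij')
      have ti : IsTight d (x ++ [i]) := hxt.concat (by rw [ci, ev]; exact hji)
      have e1 := ih cj.symm hu' tj (by rw [eu]; exact h.symm hval hi) (by omega)
      have e2 := ih ci.symm hv' ti (by rw [ev]; exact h.symm hval hj) (by omega)
      have e1' := commEquiv_append_right e1 [i]
      have e2' := commEquiv_append_right e2 [j]
      have e3 : Relation.EqvGen CommStep (x ++ [j] ++ [i]) (x ++ [i] ++ [j]) :=
        commEquiv_concat_pair (by unfold Commutes at *; omega) x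
      exact .trans _ _ _ e1' (.trans _ _ _ e3 (.symm _ _ e2'))

/-! ### From words to elements of the group -/

theorem evalWord_append {d n : ℕ} (u v : GWord n) :
    evalWord d n (u ++ v) = evalWord d n u * evalWord d n v := by
  simp [evalWord]

theorem evalWord_eq_of_isRelator {d n : ℕ} {x y : FreeGroup (Fin n)}
    (h : IsRelator d n (x * y⁻¹)) :
    (PresentedGroup.mk {r | IsRelator d n r} x : GGroup d n) = PresentedGroup.mk _ y := by
  have := PresentedGroup.one_of_mem (rels := {r | IsRelator d n r}) h
  rwa [map_mul, map_inv, mul_inv_eq_one] at this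

theorem evalWord_comm {d n : ℕ} {i j : Fin n} (hij : letter j + 1 < letter i) :
    evalWord d n [i, j] = evalWord d n [j, i] := by
  have := evalWord_eq_of_isRelator (IsRelator.comm (d := d) i j hij)
  simpa [evalWord, PresentedGroup.of] using this

theorem evalWord_braid {d n : ℕ} {i j : Fin n} (hij : j.val = i.val + 1) (hj : j.val + 1 < n) :
    evalWord d n [j, i, j] = evalWord d n [i, j, i] := by
  have := evalWord_eq_of_isRelator (IsRelator.braid (d := d) i j (by simp [letter, hij])
    (by simpa [letter] using hj))
  simpa [evalWord, PresentedGroup.of, mul_assoc] using this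

theorem evalWord_braid_last {d n : ℕ} {i j : Fin n} (hij : j.val = i.val + 1)
    (hj : j.val + 1 = n) : evalWord d n [j, i, j, i] = evalWord d n [i, j, i, j] := by
  have := evalWord_eq_of_isRelator (IsRelator.braid_last (d := d) i j (by simp [letter, hij])
    (by simpa [letter] using hj))
  simpa [evalWord, PresentedGroup.of, mul_assoc] using this

theorem evalWord_eq_of_commEquiv {d n : ℕ} {u v : GWord n} (h : Relation.EqvGen CommStep u v) :
    evalWord d n u = evalWord d n v ∧ u.length = v.length := by
  induction h with
  | rel _ _ h =>
    obtain ⟨a, b, i, j, hij⟩ := h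
    simp only [evalWord_append, evalWord_comm hij]
    simp
  | refl _ => exact ⟨rfl, rfl⟩
  | symm _ _ _ ih => exact ⟨ih.1.symm, ih.2.symm⟩
  | trans _ _ _ _ _ ih1 ih2 => exact ⟨ih1.1.trans ih2.1, ih1.2.trans ih2.2⟩

theorem isFullyCommutative_of_avoidsPatterns {d n : ℕ} [NeZero d] {u : GWord n}
    (hu : IsTight d u) (h : AvoidsPatterns n (config d u)) :
    IsFullyCommutative (evalWord d n u) := by
  refine ⟨u, Set.Subset.antisymm (fun v hv => ?_) fun v hv => ?_⟩
  · obtain ⟨h1, h2⟩ := hu.of_mem_reducedWords hv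
    exact commEquiv_of_avoidsPatterns h1.symm hu h2 h
  · have := evalWord_eq_of_commEquiv (d := d) hv
    exact hu.mem_reducedWords this.1.symm this.2.symm

/-! ### Braids as obstructions -/

theorem IsFullyCommutative.commEquiv {d n : ℕ} [NeZero d] {u v : GWord n}
    (h : IsFullyCommutative (evalWord d n u)) (hu : IsTight d u)
    (hv : evalWord d n v = evalWord d n u) (hlen : v.length = u.length) :
    Relation.EqvGen CommStep u v := by
  obtain ⟨x, hx⟩ := h
  have h1 : u ∈ commClass x := hx ▸ hu.mem_reducedWords rfl rfl
  have h2 : v ∈ commClass x := hx ▸ hu.mem_reducedWords hv hlen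
  exact .trans _ _ _ (.symm _ _ h1) h2

/-- The subword of the letters with two consecutive indices is an invariant of commutations. -/
theorem filter_eq_of_commEquiv {n : ℕ} {u v : GWord n} (h : Relation.EqvGen CommStep u v)
    (m : ℕ) : u.filter (fun i => i.val = m ∨ i.val = m + 1) =
      v.filter (fun i => i.val = m ∨ i.val = m + 1) := by
  induction h with
  | rel _ _ h =>
    obtain ⟨a, b, i, j, hij⟩ := h
    simp only [letter] at hij
    simp only [List.filter_append, List.filter_cons, List.filter_nil]
    congr 2
    by_cases h1 : i.val = m ∨ i.val = m + 1 <;> by_cases h2 : j.val = m ∨ j.val = m + 1 <;>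
      simp [h1, h2]
    omega
  | refl _ => rfl
  | symm _ _ _ ih => exact ih.symm
  | trans _ _ _ _ _ ih1 ih2 => exact ih1.trans ih2

theorem commEquiv_move {n : ℕ} (i : Fin n) (y : GWord n) (h : ∀ k ∈ y, Commutes i k) :
    Relation.EqvGen CommStep ([i] ++ y) (y ++ [i]) := by
  induction y with
  | nil => exact .refl _
  | cons k y ih =>
    have h1 := commEquiv_append_right (commEquiv_pair (h k (by simp))) y
    have h2 := commEquiv_append_left (ih fun k hk => h k (by simp [hk])) [k]
    simp only [List.cons_append, List.nil_append] at h1 h2 ⊢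
    exact .trans _ _ _ h1 h2

/-- A word with two occurrences of a letter `i` below `n`, separated by letters that commute
with `i` and a single neighbour of `i` below `n`. -/
def HasBraid {n : ℕ} (u : GWord n) : Prop :=
  ∃ (x y₁ y₂ z : GWord n) (i j : Fin n), u = x ++ ([i] ++ y₁) ++ [j] ++ (y₂ ++ [i]) ++ z ∧
    (∀ k ∈ y₁, Commutes i k) ∧ (∀ k ∈ y₂, Commutes i k) ∧
    (i.val = j.val + 1 ∨ j.val = i.val + 1) ∧ i.val + 1 < n ∧ j.val + 1 < n

theorem HasBraid.append {n : ℕ} {u : GWord n} (h : HasBraid u) (w : GWord n) :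
    HasBraid (u ++ w) := by
  obtain ⟨x, y₁, y₂, z, i, j, rfl, h⟩ := h
  exact ⟨x, y₁, y₂, z ++ w, i, j, by simp, h⟩

theorem not_commEquiv_of_ne {n : ℕ} {x v w : GWord n} {i j : Fin n}
    (hij : i.val = j.val + 1 ∨ j.val = i.val + 1) :
    ¬ Relation.EqvGen CommStep (x ++ i :: v) (x ++ j :: w) := by
  intro h
  -- With the smaller index, the filter keeps precisely the letters `i` and `j`, which are the first
  -- ones to differ.
  have := filter_eq_of_commEquiv h (min i.val j.val)
  rw [List.filter_append, List.filter_append, List.append_cancel_left_eq,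
    List.filter_cons_of_pos (by simp; omega), List.filter_cons_of_pos (by simp; omega)] at this
  have := congrArg Fin.val (List.cons.inj this).1
  omega

/-- An element with two tight words that start to differ in neighbouring letters. -/
theorem not_isFullyCommutative {d n : ℕ} [NeZero d] {u x v w : GWord n} {i j : Fin n}
    (hu : IsTight d u) (hij : i.val = j.val + 1 ∨ j.val = i.val + 1)
    (huv : Relation.EqvGen CommStep u (x ++ i :: v))
    (hvw : evalWord d n (i :: v) = evalWord d n (j :: w)) (hlen : v.length = w.length) :
    ¬ IsFullyCommutative (evalWord d n u) := by
  intro h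
  have h1 := evalWord_eq_of_commEquiv (d := d) huv
  have h2 := h.commEquiv hu (v := x ++ j :: w)
    (by rw [h1.1, evalWord_append, evalWord_append, hvw]) (by rw [h1.2]; simp [hlen])
  exact not_commEquiv_of_ne hij (.trans _ _ _ (.symm _ _ huv) h2)

/-- Commutations carry the two letters `i` to either side of `j`; the braid relation then changes
the first letter of the factor into its neighbour. -/
theorem HasBraid.not_isFullyCommutative {d n : ℕ} [NeZero d] {u : GWord n} (h : HasBraid u)
    (hu : IsTight d u) : ¬ IsFullyCommutative (evalWord d n u) := by
  obtain ⟨x, y₁, y₂, z, i, j, hu', h1, h2, hij, hi, hj⟩ := h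
  have e1 := commEquiv_append_right (commEquiv_append_left (commEquiv_move i y₁ h1) x)
    ([j] ++ (y₂ ++ [i]) ++ z)
  have e2 := commEquiv_append_right (commEquiv_append_left (commEquiv_move i y₂ h2)
    (x ++ (y₁ ++ [i]) ++ [j])) z
  have e3 : Relation.EqvGen CommStep u ((x ++ y₁) ++ i :: (j :: i :: (y₂ ++ z))) := by
    rw [hu']
    simp only [List.append_assoc, List.cons_append, List.nil_append] at e1 e2 ⊢
    exact .trans _ _ _ e1 (.symm _ _ e2)
  have e4 : evalWord d n (i :: (j :: i :: (y₂ ++ z))) =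
      evalWord d n (j :: (i :: j :: (y₂ ++ z))) := by
    have : evalWord d n [i, j, i] = evalWord d n [j, i, j] := by
      rcases hij with hij | hij
      · exact evalWord_braid hij hi
      · exact (evalWord_braid hij hj).symm
    rw [show i :: j :: i :: (y₂ ++ z) = [i, j, i] ++ (y₂ ++ z) by simp,
      show j :: i :: j :: (y₂ ++ z) = [j, i, j] ++ (y₂ ++ z) by simp, evalWord_append,
      this, ← evalWord_append]
  exact _root_.not_isFullyCommutative hu hij e3 e4 (by simp)

theorem evalWord_replicate {d n : ℕ} (i : Fin n) (b : ℕ) :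
    evalWord d n (List.replicate b i) = PresentedGroup.of i ^ b := by
  simp [evalWord]

/-- Write `s` and `t` for the generators. The relation says that `s t s` commutes with `t`; since
`s` is an involution, `s t^b s = (s t s)^b` commutes with `t` as well. -/
theorem evalWord_braid_last_pow {d n : ℕ} {i j : Fin n} (hij : j.val = i.val + 1)
    (hj : j.val + 1 = n) (b : ℕ) :
    evalWord d n ([i] ++ List.replicate b j ++ [i] ++ [j]) =
      evalWord d n ([j] ++ [i] ++ List.replicate b j ++ [i]) := by
  have hb := evalWord_braid_last (d := d) hij hj
  have hsq : (PresentedGroup.of i : GGroup d n) * PresentedGroup.of i = 1 := by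
    have := PresentedGroup.one_of_mem (rels := {r | IsRelator d n r})
      (IsRelator.order_two (d := d) i (by simp only [letter]; omega))
    rwa [map_pow, pow_two] at this
  simp only [evalWord_append, evalWord_replicate]
  simp only [evalWord, List.map_cons, List.map_nil, List.prod_cons, List.prod_nil, mul_one] at hb ⊢
  generalize (PresentedGroup.of i : GGroup d n) = s at *
  generalize (PresentedGroup.of j : GGroup d n) = t at *
  have hc : Commute (s * t * s) t := by
    unfold Commute SemiconjBy
    simp only [mul_assoc] at hb ⊢
    exact hb.symm
  have hp : s * t ^ b * s = (s * t * s) ^ b := by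
    have hinv : s⁻¹ = s := inv_eq_of_mul_eq_one_left hsq
    have := conj_pow (i := b) (a := s) (b := t)
    rw [hinv] at this
    exact this.symm
  have := (hc.pow_left b).eq
  rw [← hp] at this
  simpa [mul_assoc] using this

/-- A word with a subword `s_{n-1} s_n^b s_{n-1} s_n`, up to letters that commute with `s_n`. -/
def HasBraidLast {n : ℕ} (u : GWord n) : Prop :=
  ∃ (x y z : GWord n) (b : ℕ) (i j : Fin n),
    u = x ++ ([i] ++ List.replicate b j ++ [i]) ++ (y ++ [j]) ++ z ∧
    (∀ k ∈ y, Commutes j k) ∧ j.val = i.val + 1 ∧ j.val + 1 = n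

theorem HasBraidLast.append {n : ℕ} {u : GWord n} (h : HasBraidLast u) (w : GWord n) :
    HasBraidLast (u ++ w) := by
  obtain ⟨x, y, z, b, i, j, rfl, h⟩ := h
  exact ⟨x, y, z ++ w, b, i, j, by simp, h⟩

theorem HasBraidLast.not_isFullyCommutative {d n : ℕ} [NeZero d] {u : GWord n}
    (h : HasBraidLast u) (hu : IsTight d u) : ¬ IsFullyCommutative (evalWord d n u) := by
  obtain ⟨x, y, z, b, i, j, hu', h1, hij, hj⟩ := h
  have e2 := commEquiv_append_right (commEquiv_append_left (commEquiv_move j y h1)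
    (x ++ ([i] ++ List.replicate b j ++ [i]))) z
  have e3 : Relation.EqvGen CommStep u
      (x ++ i :: (List.replicate b j ++ [i] ++ [j] ++ y ++ z)) := by
    rw [hu']
    simp only [List.append_assoc, List.cons_append, List.nil_append] at e2 ⊢
    exact .symm _ _ e2
  have e4 : evalWord d n (i :: (List.replicate b j ++ [i] ++ [j] ++ y ++ z)) =
      evalWord d n (j :: ([i] ++ List.replicate b j ++ [i] ++ y ++ z)) := by
    have := evalWord_braid_last_pow (d := d) hij hj b
    rw [show i :: (List.replicate b j ++ [i] ++ [j] ++ y ++ z) =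
      ([i] ++ List.replicate b j ++ [i] ++ [j]) ++ (y ++ z) by simp,
      show j :: ([i] ++ List.replicate b j ++ [i] ++ y ++ z) =
      ([j] ++ [i] ++ List.replicate b j ++ [i]) ++ (y ++ z) by simp, evalWord_append, this,
      ← evalWord_append]
  exact _root_.not_isFullyCommutative hu (by omega) e3 e4 (by simp; omega)

/-! ### Descending words and blocks -/

theorem mem_descWord {n i j : ℕ} {k : Fin n} : k ∈ descWord n i j ↔ j ≤ letter k ∧ letter k ≤ i := by
  simp [descWord]

theorem pairwise_descWord (n i j : ℕ) : (descWord n i j).Pairwise (· > ·) := by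
  refine List.Pairwise.filter _ ?_
  rw [List.pairwise_reverse]
  exact List.pairwise_lt_finRange n

theorem eq_of_pairwise_gt {n : ℕ} {u v : GWord n} (hu : u.Pairwise (· > ·))
    (hv : v.Pairwise (· > ·)) (h : ∀ k, k ∈ u ↔ k ∈ v) : u = v :=
  List.Perm.eq_of_pairwise (fun _ _ _ _ h1 h2 => absurd h1 (not_lt_of_gt h2)) hu hv
    ((List.perm_ext_iff_of_nodup (hu.imp fun h => ne_of_gt h) (hv.imp fun h => ne_of_gt h)).2 h)

theorem descWord_split {n i m j : ℕ} (h1 : j ≤ m + 1) (h2 : m ≤ i) :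
    descWord n i j = descWord n i (m + 1) ++ descWord n m j := by
  refine eq_of_pairwise_gt (pairwise_descWord _ _ _) ?_ fun k => ?_
  · rw [List.pairwise_append]
    refine ⟨pairwise_descWord _ _ _, pairwise_descWord _ _ _, fun a ha b hb => ?_⟩
    rw [mem_descWord] at ha hb
    simp only [letter] at ha hb
    show b.val < a.val
    omega
  · simp only [List.mem_append, mem_descWord]
    omega

theorem descWord_singleton {n i : ℕ} (k : Fin n) (hk : letter k = i) : descWord n i i = [k] := by
  refine eq_of_pairwise_gt (pairwise_descWord _ _ _) (List.pairwise_singleton _ _) fun l => ?_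
  simp only [mem_descWord, List.mem_singleton, Fin.ext_iff]
  simp only [letter] at *
  omega

theorem descWord_of_lt {n i j : ℕ} (h : i < j) : descWord n i j = [] := by
  rw [List.eq_nil_iff_forall_not_mem]
  intro k
  rw [mem_descWord]
  omega

theorem descWord_concat {n i j : ℕ} (k : Fin n) (hk : letter k = j) (h : j ≤ i) :
    descWord n i j = descWord n i (j + 1) ++ [k] := by
  rw [descWord_split (m := j) (by omega) h, descWord_singleton k hk]

theorem descWord_cons {n i j : ℕ} (k : Fin n) (hk : letter k = i + 1) (h : j ≤ i + 1) :
    descWord n (i + 1) j = k :: descWord n i j := by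
  rw [descWord_split (m := i) h (by omega), descWord_singleton k hk]
  rfl

theorem descWord_concat_mk {n i m : ℕ} (h : m < n) (hi : m + 1 ≤ i) :
    descWord n i (m + 1) = descWord n i (m + 2) ++ [⟨m, h⟩] :=
  descWord_concat ⟨m, h⟩ rfl hi

theorem blockWord_eq {n : ℕ} (l : Fin n) (hl : letter l = n) (t j : ℕ) :
    blockWord n t j = List.replicate t l ++ descWord n (n - 1) j := by
  rw [blockWord, descWord_singleton l hl]
  congr 1
  induction t with
  | zero => rfl
  | succ t ih => simp [List.replicate_succ, ih]

/-- The descending word contains `l + 1` followed by `l`. All letters between the first `l` and this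
`l + 1` are at least `l + 2` and commute with `l`. -/
theorem hasBraid_descWord {n p j : ℕ} (x y : GWord n) (l : Fin n) (hp : p + 1 ≤ n)
    (hl : letter l < p) (hj : j ≤ letter l) (hy : ∀ k ∈ y, letter l + 2 ≤ letter k) :
    HasBraid (x ++ [l] ++ y ++ descWord n p j) := by
  simp only [letter] at hl
  let k : Fin n := ⟨l.val + 1, by omega⟩
  have hk : letter k = letter l + 1 := rfl
  refine ⟨x, y ++ descWord n p (letter l + 2), [], descWord n (letter l - 1) j, l, k, ?_, ?_, ?_,
    Or.inr rfl, by omega, by simp only [k]; omega⟩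
  · rw [descWord_split (m := letter l) (by omega) (by simp only [letter]; omega),
      show descWord n p (letter l + 1) = descWord n p (letter l + 2) ++ [k] from
        descWord_concat (i := p) k hk (by simp only [letter]; omega),
      show descWord n (letter l) j = l :: descWord n (letter l - 1) j from
        descWord_cons (i := letter l - 1) l rfl (by simpa [letter] using hj)]
    simp
  · intro i hi
    have hi' : letter l + 2 ≤ letter i := by
      rw [List.mem_append, mem_descWord] at hi
      rcases hi with hi | hi
      · exact hy i hi
      · exact hi.1
    simp only [letter] at hi'
    exact Or.inl (by omega)
  · simp

/-! ### Prefixes without a braid -/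

/-- The words `s_{1 i_1} ⋯ s_{m i_m}`. -/
def IsPrefixUpTo (n m : ℕ) (u : GWord n) : Prop :=
  ∃ i : ℕ → ℕ, (∀ p, 1 ≤ p → p ≤ m → 1 ≤ i p ∧ i p ≤ p + 1) ∧
    u = ((List.range' 1 m).map fun p => descWord n p (i p)).flatten

theorem isPrefixUpTo_zero {n : ℕ} {u : GWord n} : IsPrefixUpTo n 0 u ↔ u = [] := by
  constructor
  · rintro ⟨i, -, rfl⟩
    simp
  · rintro rfl
    exact ⟨fun _ => 0, fun p _ _ => by omega, by simp⟩

theorem isPrefixUpTo_succ {n m : ℕ} {u : GWord n} : IsPrefixUpTo n (m + 1) u ↔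
    ∃ v i, IsPrefixUpTo n m v ∧ 1 ≤ i ∧ i ≤ m + 2 ∧ u = v ++ descWord n (m + 1) i := by
  constructor
  · rintro ⟨i, hi, rfl⟩
    refine ⟨_, i (m + 1), ⟨i, fun p h1 h2 => hi p h1 (by omega), rfl⟩,
      (hi (m + 1) (by omega) le_rfl).1, (hi (m + 1) (by omega) le_rfl).2, ?_⟩
    rw [List.range'_1_concat]
    simp [add_comm]
  · rintro ⟨v, j, ⟨i, hi, rfl⟩, h1, h2, rfl⟩
    refine ⟨Function.update i (m + 1) j, fun p h3 h4 => ?_, ?_⟩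
    · by_cases hp : p = m + 1
      · subst hp
        simp [h1, h2]
      · rw [Function.update_of_ne hp]
        exact hi p h3 (by omega)
    · rw [List.range'_1_concat, List.map_append, List.flatten_append]
      congr 2
      · refine List.map_congr_left fun p hp => ?_
        rw [List.mem_range'_1] at hp
        rw [Function.update_of_ne (by omega)]
      · simp [add_comm]

/-- The words `s_{1 i_1} ⋯ s_{m i_m}` that express the fully commutative permutations of `m + 1`
letters which increase from position `k` on, where positions start at `0`. -/
def goodWords (n : ℕ) : ℕ → ℕ → Finset (GWord n)
  | 0, _ => {[]}
  | m + 1, k => goodWords n m k ∪ (Finset.range (min k (m + 1))).biUnion fun i =>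
      (goodWords n m i).image (· ++ descWord n (m + 1) (i + 1))

/-- The alternatives are an empty last block and a block that moves the maximum to position `i`. The
latter needs values that increase from `i` on, and the result increases from `k` on only if the
maximum lands before `k`. -/
theorem mem_goodWords_succ {n m k : ℕ} {u : GWord n} : u ∈ goodWords n (m + 1) k ↔
    u ∈ goodWords n m k ∨ ∃ i v, i < k ∧ i ≤ m ∧ v ∈ goodWords n m i ∧
      u = v ++ descWord n (m + 1) (i + 1) := by
  simp only [goodWords, Finset.mem_union, Finset.mem_biUnion, Finset.mem_range, Finset.mem_image,
    lt_min_iff, Nat.lt_succ_iff]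
  grind

theorem goodWords_mono {n m k k' : ℕ} (h : k ≤ k') : goodWords n m k ⊆ goodWords n m k' := by
  induction m with
  | zero => simp [goodWords]
  | succ m ih =>
    intro u hu
    rw [mem_goodWords_succ] at hu ⊢
    rcases hu with hu | ⟨i, v, h1, h2⟩
    · exact Or.inl (ih hu)
    · exact Or.inr ⟨i, v, by omega, h2⟩

theorem letter_le_of_mem_goodWords {n m k : ℕ} {u : GWord n} (hu : u ∈ goodWords n m k) :
    ∀ l ∈ u, letter l ≤ m := by
  induction m generalizing k u with
  | zero => simp_all [goodWords]
  | succ m ih =>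
    intro l hl
    rw [mem_goodWords_succ] at hu
    rcases hu with hu | ⟨i, v, h1, h2, h3, rfl⟩
    · have := ih hu l hl
      omega
    · rw [List.mem_append, mem_descWord] at hl
      rcases hl with hl | hl
      · have := ih h3 l hl
        omega
      · exact hl.2

theorem exists_concat_of_mem_goodWords {n m k : ℕ} {u : GWord n} (hm : m ≤ n)
    (hu : u ∈ goodWords n m k) : u = [] ∨ ∃ x l, u = x ++ [l] ∧ letter l ≤ k := by
  induction m generalizing k u with
  | zero => simp_all [goodWords]
  | succ m ih =>
    rw [mem_goodWords_succ] at hu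
    rcases hu with hu | ⟨i, v, h1, h2, h3, rfl⟩
    · exact ih (by omega) hu
    · refine Or.inr ⟨v ++ descWord n (m + 1) (i + 2), ⟨i, by omega⟩, ?_, by simp [letter]; omega⟩
      rw [descWord_concat_mk (by omega) (by omega), List.append_assoc]

/-- The last nonempty block decides the matter: it fails the bound `k` only if it ends beyond `k`.
Its last letter is the one with which later braids begin. -/
theorem exists_concat_of_not_mem_goodWords {n m k K : ℕ} {u : GWord n} (hm : m ≤ n)
    (hu : u ∈ goodWords n m K) (hk : u ∉ goodWords n m k) :
    ∃ x l, u = x ++ [l] ∧ k < letter l ∧ letter l ≤ m := by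
  induction m generalizing K u with
  | zero => simp_all [goodWords]
  | succ m ih =>
    rw [mem_goodWords_succ] at hu
    rcases hu with hu | ⟨i, v, h1, h2, h3, rfl⟩
    · obtain ⟨x, l, h⟩ := ih (by omega) hu fun h => hk (mem_goodWords_succ.2 (Or.inl h))
      exact ⟨x, l, h.1, h.2.1, by omega⟩
    · have hik : k ≤ i := by
        by_contra hik
        exact hk (mem_goodWords_succ.2 (Or.inr ⟨i, v, by omega, h2, h3, rfl⟩))
      refine ⟨v ++ descWord n (m + 1) (i + 2), ⟨i, by omega⟩, ?_, by simp [letter]; omega,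
        by simp [letter]; omega⟩
      rw [descWord_concat_mk (by omega) (by omega), List.append_assoc]

theorem isPrefixUpTo_of_mem_goodWords {n m k : ℕ} {u : GWord n} (hu : u ∈ goodWords n m k) :
    IsPrefixUpTo n m u := by
  induction m generalizing k u with
  | zero => simp_all [goodWords, isPrefixUpTo_zero]
  | succ m ih =>
    rw [mem_goodWords_succ] at hu
    rw [isPrefixUpTo_succ]
    rcases hu with hu | ⟨i, v, h1, h2, h3, rfl⟩
    · exact ⟨u, m + 2, ih hu, by omega, le_rfl, by rw [descWord_of_lt (by omega)]; simp⟩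
    · exact ⟨v, i + 1, ih h3, by omega, by omega, rfl⟩

/-- If `v` is not good for the new block, then it ends in a letter `l` with `i < l ≤ m`, and the
block runs through `l + 1` and `l`. -/
theorem mem_goodWords_or_hasBraid {n m : ℕ} {u : GWord n} (hm : m + 1 ≤ n)
    (hu : IsPrefixUpTo n m u) : u ∈ goodWords n m m ∨ HasBraid u := by
  induction m generalizing u with
  | zero => simp_all [goodWords, isPrefixUpTo_zero]
  | succ m ih =>
    obtain ⟨v, i, hv, h1, h2, rfl⟩ := isPrefixUpTo_succ.1 hu
    rcases ih (by omega) hv with hv | hv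
    · rcases Nat.lt_or_ge (m + 1) i with hi | hi
      · left
        rw [descWord_of_lt hi, List.append_nil]
        exact mem_goodWords_succ.2 (Or.inl (goodWords_mono (by omega) hv))
      · obtain ⟨i, rfl⟩ : ∃ i', i = i' + 1 := ⟨i - 1, by omega⟩
        by_cases hvi : v ∈ goodWords n m i
        · exact Or.inl (mem_goodWords_succ.2 (Or.inr ⟨i, v, by omega, by omega, hvi, rfl⟩))
        · right
          obtain ⟨x, l, rfl, h3, h4⟩ := exists_concat_of_not_mem_goodWords (by omega) hv hvi
          simpa using hasBraid_descWord (p := m + 1) (j := i + 1) x [] l hm (by omega) (by omega)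
            (by simp)
    · exact Or.inr (hv.append _)

/-! ### The Catalan triangle and the number of good prefixes -/

theorem catalanTriangle_zero (n : ℕ) : catalanTriangle n 0 = 1 := by
  unfold catalanTriangle
  rw [Nat.factorial_succ]
  have : (n ! : ℚ) ≠ 0 := by exact_mod_cast n.factorial_ne_zero
  have : (n : ℚ) + 1 ≠ 0 := by positivity
  push_cast
  field_simp
  simp [mul_comm]

theorem catalanTriangle_succ (n k : ℕ) :
    catalanTriangle (n + 1) (k + 1) = catalanTriangle (n + 1) k + catalanTriangle n (k + 1) := by
  unfold catalanTriangle
  rw [show n + 1 + (k + 1) = (n + k + 1) + 1 by omega, show n + 1 + k = n + k + 1 by omega,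
    show n + (k + 1) = n + k + 1 by omega, Nat.factorial_succ (n + k + 1),
    Nat.factorial_succ (n + 1), Nat.factorial_succ k]
  have h1 : ((n + 1)! : ℚ) ≠ 0 := by exact_mod_cast (n + 1).factorial_ne_zero
  have h2 : (k ! : ℚ) ≠ 0 := by exact_mod_cast k.factorial_ne_zero
  have h3 : (n : ℚ) + 1 + 1 ≠ 0 := by positivity
  have h4 : (k : ℚ) + 1 ≠ 0 := by positivity
  push_cast
  field_simp
  ring

theorem catalanTriangle_self_succ (n : ℕ) : catalanTriangle n (n + 1) = 0 := by
  simp [catalanTriangle]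

theorem catalanTriangle_self (n : ℕ) :
    catalanTriangle (n + 1) (n + 1) = catalanTriangle (n + 1) n := by
  rw [catalanTriangle_succ, catalanTriangle_self_succ, add_zero]

theorem sum_catalanTriangle (n k : ℕ) :
    ∑ i ∈ Finset.range k, catalanTriangle n i + catalanTriangle n k =
      catalanTriangle (n + 1) k := by
  induction k with
  | zero => simp [catalanTriangle_zero]
  | succ k ih => rw [Finset.sum_range_succ, ih, catalanTriangle_succ]

theorem concat_descWord_inj {n m i j : ℕ} {u v : GWord n} (hi : i ≤ m) (hj : j ≤ m)
    (hm : m + 1 ≤ n) (h : u ++ descWord n (m + 1) (i + 1) = v ++ descWord n (m + 1) (j + 1)) :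
    i = j := by
  rw [descWord_concat_mk (m := i) (by omega) (by omega),
    descWord_concat_mk (m := j) (by omega) (by omega),
    ← List.append_assoc, ← List.append_assoc] at h
  have := List.append_inj_right' h rfl
  simpa using this

theorem mem_append_descWord {n m i : ℕ} (u : GWord n) (hi : i ≤ m) (hm : m + 1 ≤ n) :
    (⟨m, hm⟩ : Fin n) ∈ u ++ descWord n (m + 1) (i + 1) := by
  rw [List.mem_append, mem_descWord]
  simp only [letter]
  omega

/-- The letter `m + 1` detects a nonempty last block and the final letter gives its `i`, so the
union in the recursion is disjoint and the counts add up by `sum_catalanTriangle`. A bound `k` above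
`m` is no restriction, whence the minimum. -/
theorem card_goodWords {n m k : ℕ} (hm : m ≤ n) :
    ((goodWords n m k).card : ℚ) = catalanTriangle (m + 1) (min k m) := by
  induction m generalizing k with
  | zero => simp [goodWords, catalanTriangle_zero]
  | succ m ih =>
    rw [goodWords, Finset.card_union_of_disjoint, Finset.card_biUnion]
    · simp_rw [Finset.card_image_of_injective _ (List.append_left_injective _)]
      push_cast
      have hsum : ∑ i ∈ Finset.range (min k (m + 1)), ((goodWords n m i).card : ℚ) =
          ∑ i ∈ Finset.range (min k (m + 1)), catalanTriangle (m + 1) i := by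
        refine Finset.sum_congr rfl fun i hi => ?_
        rw [Finset.mem_range] at hi
        rw [ih (by omega), show min i m = i by omega]
      rw [ih (by omega), hsum, add_comm]
      · rcases Nat.lt_or_ge k (m + 1) with hk | hk
        · rw [show min k m = k by omega, show min k (m + 1) = k by omega, sum_catalanTriangle]
        -- The sum stops at `i = m`; the term for the empty block is read as the entry at `m + 1`,
        -- so that the summation formula applies.
        · rw [show min k m = m by omega, show min k (m + 1) = m + 1 by omega,
            ← catalanTriangle_self, sum_catalanTriangle]
    · intro i hi j hj hij
      rw [Finset.mem_coe, Finset.mem_range] at hi hj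
      show Disjoint _ _
      rw [Finset.disjoint_left]
      intro u hu hu'
      rw [Finset.mem_image] at hu hu'
      obtain ⟨v, -, rfl⟩ := hu
      obtain ⟨w, -, hw⟩ := hu'
      exact hij (concat_descWord_inj (by omega) (by omega) hm hw.symm)
    · rw [Finset.disjoint_left]
      intro u hu hu'
      simp only [Finset.mem_biUnion, Finset.mem_range, Finset.mem_image] at hu'
      obtain ⟨i, hi, v, -, rfl⟩ := hu'
      have := letter_le_of_mem_goodWords hu _ (mem_append_descWord v (by omega) hm)
      simp [letter] at this

/-! ### Prefixes for a single block -/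

/-- The words `s_{1 i_1} ⋯ s_{m i_m}` with `m = k + e` that express the fully commutative
permutations of `m + 1` letters which increase from position `k` to the last position but one. -/
def nearlyGoodWords (n k : ℕ) : ℕ → Finset (GWord n)
  | 0 => goodWords n k k
  | e + 1 => goodWords n (k + e + 1) k ∪
      (nearlyGoodWords n k e).image (· ++ descWord n (k + e + 1) (k + e + 1))

theorem mem_nearlyGoodWords_succ {n k e : ℕ} {u : GWord n} : u ∈ nearlyGoodWords n k (e + 1) ↔
    u ∈ goodWords n (k + e + 1) k ∨
      ∃ v ∈ nearlyGoodWords n k e, u = v ++ descWord n (k + e + 1) (k + e + 1) := by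
  simp only [nearlyGoodWords, Finset.mem_union, Finset.mem_image]
  grind

theorem nearlyGoodWords_subset (n k e : ℕ) :
    nearlyGoodWords n k e ⊆ goodWords n (k + e) (k + e) := by
  induction e with
  | zero => exact subset_rfl
  | succ e ih =>
    intro u hu
    rcases mem_nearlyGoodWords_succ.1 hu with hu | ⟨v, hv, rfl⟩
    · exact goodWords_mono (by omega) hu
    · exact mem_goodWords_succ.2 (Or.inr ⟨k + e, v, by omega, le_rfl, ih hv, rfl⟩)

/-- The recursion is the addition rule of the triangle. Its two parts are disjoint: words of the
first kind are empty or end in a letter at most `k`, the others end in `k + e + 1`. -/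
theorem card_nearlyGoodWords {n k e : ℕ} (h : k + e ≤ n) :
    ((nearlyGoodWords n k e).card : ℚ) = catalanTriangle (k + e + 1) (k + 1) := by
  induction e with
  | zero =>
    rw [nearlyGoodWords, card_goodWords (by omega), min_self, add_zero, catalanTriangle_self]
  | succ e ih =>
    rw [nearlyGoodWords, Finset.card_union_of_disjoint,
      Finset.card_image_of_injective _ (List.append_left_injective _)]
    · push_cast
      rw [ih (by omega), card_goodWords (by omega), show min k (k + e + 1) = k by omega, ← add_assoc,
        ← catalanTriangle_succ]
    · rw [Finset.disjoint_left]
      intro u hu hu'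
      rw [Finset.mem_image] at hu'
      obtain ⟨v, -, rfl⟩ := hu'
      rw [descWord_singleton (i := k + e + 1) ⟨k + e, by omega⟩ rfl] at hu
      rcases exists_concat_of_mem_goodWords h hu with h1 | ⟨x, l, h1, h2⟩
      · simp at h1
      · have := List.append_inj_right' h1 rfl
        simp only [List.cons.injEq, and_true] at this
        subst this
        simp only [letter] at h2
        omega

/-- After stripping trailing blocks of a single letter, which form `y`, the word ends in a letter
`l` that violates the condition. It lies far enough below the stripped letters to commute with them.
-/
theorem exists_of_not_mem_nearlyGoodWords {n k e : ℕ} {u : GWord n} (h : k + e ≤ n)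
    (hu : u ∈ goodWords n (k + e) (k + e)) (hu' : u ∉ nearlyGoodWords n k e) :
    ∃ x l y, u = x ++ [l] ++ y ∧ k < letter l ∧ letter l < k + e ∧
      ∀ i ∈ y, letter l + 2 ≤ letter i := by
  induction e generalizing u with
  | zero => exact absurd hu hu'
  | succ e ih =>
    rw [mem_nearlyGoodWords_succ, not_or] at hu'
    obtain ⟨h1, h2⟩ := hu'
    rw [← add_assoc, mem_goodWords_succ] at hu
    rcases hu with hu | ⟨i, v, h3, h4, h5, rfl⟩
    · obtain ⟨x, l, rfl, h6, h7⟩ := exists_concat_of_not_mem_goodWords (by omega) hu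
        fun hh => h1 (mem_goodWords_succ.2 (Or.inl hh))
      exact ⟨x, l, [], by simp, h6, by omega, by simp⟩
    · have hki : k ≤ i := by
        by_contra hki
        exact h1 (mem_goodWords_succ.2 (Or.inr ⟨i, v, by omega, h4, h5, rfl⟩))
      rcases h4.lt_or_eq with h6 | rfl
      · refine ⟨v ++ descWord n (k + e + 1) (i + 2), ⟨i, by omega⟩, [], ?_, by simp [letter]; omega,
          by simp [letter]; omega, by simp⟩
        rw [descWord_concat_mk (m := i) (by omega) (by omega)]
        simp
      · obtain ⟨x, l, y, rfl, h7, h8, h9⟩ := ih (by omega) h5 fun hv => h2 ⟨_, hv, rfl⟩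
        refine ⟨x, l, y ++ descWord n (k + e + 1) (k + e + 1), by simp, h7, by omega, ?_⟩
        intro i hi
        rw [List.mem_append, mem_descWord] at hi
        rcases hi with hi | hi
        · exact h9 i hi
        · omega

/-! ### Configurations and tightness of blocks -/

/-- The entry at position `m` is moved to position `i`. -/
def moveTo {d : ℕ} (m i : ℕ) (a : Config d) : Config d := fun q =>
  if q = i then a m else if i < q ∧ q ≤ m then a (q - 1) else a q

theorem moveTo_self {d : ℕ} (m : ℕ) (a : Config d) : moveTo m m a = a := by
  funext q
  unfold moveTo
  grind

theorem run_descWord {d n m i : ℕ} (hm : m + 1 ≤ n) (hi : i ≤ m) (a : Config d) :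
    run (descWord n m (i + 1)) a = moveTo m i a := by
  induction m generalizing a with
  | zero =>
    obtain rfl : i = 0 := by omega
    rw [descWord_of_lt (by omega), moveTo_self, run_nil]
  | succ m ih =>
    rcases hi.lt_or_eq with h | rfl
    · rw [descWord_cons (i := m) (j := i + 1) ⟨m, by omega⟩ rfl (by omega), run_cons, ih (by omega) (by omega),
        stepPerm_of_lt (by simpa using hm)]
      funext q
      simp only [moveTo, Function.comp_apply, Equiv.swap_apply_def]
      grind
    · rw [descWord_of_lt (by omega), moveTo_self, run_nil]

theorem config_descWord {d n m i : ℕ} (hm : m + 1 ≤ n) (hi : i ≤ m) (u : GWord n) :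
    config d (u ++ descWord n m (i + 1)) = moveTo m i (config d u) := by
  rw [config, run_append, run_descWord hm hi]
  rfl

/-- Each letter exchanges the moving entry with a smaller one on its left, so every step ends in a
descent. -/
theorem IsTight.descWord {d n m i : ℕ} [NeZero d] {u : GWord n} (hu : IsTight d u)
    (hm : m + 1 ≤ n) (hi : i ≤ m)
    (h : ∀ q, i ≤ q → q < m → EntryGT (config d u m) (config d u q)) :
    IsTight d (u ++ descWord n m (i + 1)) := by
  induction hk : m - i generalizing i with
  | zero => rwa [descWord_of_lt (by omega), List.append_nil]
  | succ k ih =>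
    have ht := ih (i := i + 1) (by omega) (fun q h1 h2 => h q (by omega) h2) (by omega)
    have hc := config_descWord (d := d) hm hi u
    rw [descWord_concat_mk (m := i) (by omega) (by omega), ← List.append_assoc] at hc ⊢
    refine ht.concat ?_
    rw [hc]
    have h1 : moveTo m i (config d u) i = config d u m := by simp [moveTo]
    have h2 : moveTo m i (config d u) (i + 1) = config d u i := by
      simp [moveTo, show i + 1 ≤ m by omega]
    unfold IsDescent
    rw [if_pos (by simp only; omega)]
    simp only
    rw [h1, h2]
    exact h i le_rfl (by omega)

/-- The color of the last entry is set to `t` and the entry is moved to position `j`. -/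
def colorMove {d : ℕ} (n t j : ℕ) (a : Config d) : Config d :=
  moveTo (n - 1) j (Function.update a (n - 1) ((a (n - 1)).1, (t : ZMod d)))

theorem run_replicate_last {d n : ℕ} {l : Fin n} (hl : letter l = n) (t : ℕ) (a : Config d) :
    run (List.replicate t l) a = Function.update a l.val ((a l.val).1, (a l.val).2 + t) := by
  induction t generalizing a with
  | zero => simp
  | succ t ih =>
    rw [List.replicate_succ, run_cons, ih, stepPerm_of_last hl]
    simp [add_comm, add_left_comm]

theorem natCast_ne_zero_of_lt {d t : ℕ} (h1 : 1 ≤ t) (h2 : t < d) : (t : ZMod d) ≠ 0 := by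
  rw [Ne, ZMod.natCast_eq_zero_iff]
  exact fun h => by
    have := Nat.le_of_dvd h1 h
    omega

theorem config_replicate_last {d n : ℕ} {l : Fin n} (hl : letter l = n) (t : ℕ) {u : GWord n}
    (h0 : (config d u (n - 1)).2 = 0) : config d (u ++ List.replicate t l) =
      Function.update (config d u) (n - 1) ((config d u (n - 1)).1, (t : ZMod d)) := by
  have hl' : l.val = n - 1 := by
    simp only [letter] at hl
    omega
  have : config d (u ++ List.replicate t l) = run (List.replicate t l) (config d u) := by
    rw [config, run_append]
    rfl
  rw [this, run_replicate_last hl, hl', h0, zero_add]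

theorem IsTight.replicate_last {d n : ℕ} [NeZero d] {l : Fin n} (hl : letter l = n) {t : ℕ}
    (ht : t < d) {u : GWord n} (hu : IsTight d u) (h0 : (config d u (n - 1)).2 = 0) :
    IsTight d (u ++ List.replicate t l) := by
  induction t with
  | zero => simpa
  | succ t ih =>
    have hc := config_replicate_last (d := d) hl (t + 1) h0
    rw [List.replicate_succ', ← List.append_assoc] at hc ⊢
    refine (ih (by omega)).concat ?_
    simp only [letter] at hl
    unfold IsDescent
    rw [if_neg (by omega), hc, show l.val = n - 1 by omega, Function.update_self]
    exact natCast_ne_zero_of_lt (by omega) ht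

theorem config_blockWord {d n t j : ℕ} (hj : j + 1 ≤ n) {u : GWord n}
    (h0 : (config d u (n - 1)).2 = 0) :
    config d (u ++ blockWord n t (j + 1)) = colorMove n t j (config d u) := by
  have hl : letter (⟨n - 1, by omega⟩ : Fin n) = n := by simp only [letter]; omega
  rw [blockWord_eq _ hl, ← List.append_assoc, config_descWord (by omega) (by omega),
    config_replicate_last hl t h0, colorMove]

/-- Once colored, the last entry exceeds all the uncolored entries that it passes; `t < d` keeps its
color from wrapping around. -/
theorem IsTight.blockWord {d n t j : ℕ} [NeZero d] (hj : j + 1 ≤ n) (ht : 1 ≤ t) (htd : t < d)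
    {u : GWord n} (hu : IsTight d u) (h0 : ∀ q, j ≤ q → q < n → (config d u q).2 = 0) :
    IsTight d (u ++ blockWord n t (j + 1)) := by
  have hl : letter (⟨n - 1, by omega⟩ : Fin n) = n := by simp only [letter]; omega
  have h0' := h0 (n - 1) (by omega) (by omega)
  rw [blockWord_eq _ hl, ← List.append_assoc]
  refine (hu.replicate_last hl htd h0').descWord (by omega) (by omega) fun q h1 h2 => ?_
  rw [config_replicate_last hl t h0', Function.update_self, Function.update_of_ne (by omega)]
  exact Or.inl ⟨natCast_ne_zero_of_lt ht htd, h0 q h1 (by omega)⟩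

theorem colorMove_self {d n t j : ℕ} (a : Config d) :
    colorMove n t j a j = ((a (n - 1)).1, (t : ZMod d)) := by
  simp [colorMove, moveTo]

theorem colorMove_of_lt {d n t j q : ℕ} (a : Config d) (hj : j + 1 ≤ n) (hq : q < j) :
    colorMove n t j a q = a q := by
  unfold colorMove moveTo
  rw [if_neg (by omega), if_neg (by omega), Function.update_of_ne (by omega)]

theorem colorMove_of_gt {d n t j q : ℕ} (a : Config d) (hq : j < q) (hqn : q < n) :
    colorMove n t j a q = a (q - 1) := by
  unfold colorMove moveTo
  rw [if_neg (by omega), if_pos (by omega), Function.update_of_ne (by omega)]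

/-- The previous position of the entry at position `q` when the last entry is moved to `j`. -/
def source (j q : ℕ) : ℕ := if q < j then q else q - 1

theorem colorMove_of_ne {d n t j q : ℕ} (a : Config d) (hj : j + 1 ≤ n) (hq : q ≠ j)
    (hqn : q < n) : colorMove n t j a q = a (source j q) := by
  unfold source
  split_ifs with h
  · exact colorMove_of_lt a hj h
  · exact colorMove_of_gt a (by omega) hqn

theorem source_lt_source {j p q : ℕ} (hp : p ≠ j) (hq : q ≠ j) (h : p < q) :
    source j p < source j q := by
  unfold source
  grind

theorem source_lt {n j q : ℕ} (hj : j + 1 ≤ n) (hq : q ≠ j) (hqn : q < n) :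
    source j q < n - 1 := by
  unfold source
  grind

theorem le_source {j q : ℕ} (h : j < q) : j ≤ source j q := by
  unfold source
  grind

/-! ### Configurations of prefixes -/

/-- The configurations of the words `s_{1 i_1} ⋯ s_{m i_m}`. -/
structure IsPrefixConfig {d : ℕ} (m : ℕ) (a : Config d) : Prop where
  uncolored : ∀ q, (a q).2 = 0
  fix : ∀ q, m < q → (a q).1 = q
  le : ∀ q, q ≤ m → (a q).1 ≤ m

theorem IsPrefixUpTo.isTight {d n m : ℕ} [NeZero d] (hm : m + 1 ≤ n) {u : GWord n}
    (hu : IsPrefixUpTo n m u) : IsTight d u ∧ IsPrefixConfig m (config d u) := by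
  induction m generalizing u with
  | zero =>
    rw [isPrefixUpTo_zero] at hu
    subst hu
    refine ⟨by simp [IsTight, config, cost_init], fun q => rfl, fun q _ => rfl, fun q hq => hq⟩
  | succ m ih =>
    obtain ⟨v, i, hv, h1, h2, rfl⟩ := isPrefixUpTo_succ.1 hu
    obtain ⟨ht, hc⟩ := ih (by omega) hv
    obtain ⟨i, rfl⟩ : ∃ i', i = i' + 1 := ⟨i - 1, by omega⟩
    have hf := hc.fix (m + 1) (by omega)
    refine ⟨ht.descWord hm (by omega) fun q hq hqm => ?_, ?_⟩
    · have := hc.le q (by omega)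
      exact Or.inr (Or.inl ⟨hc.uncolored _, hc.uncolored _, by omega⟩)
    · rw [config_descWord hm (by omega)]
      generalize config d v = a at *
      refine ⟨fun q => ?_, fun q hq => ?_, fun q hq => ?_⟩
      · unfold moveTo
        split_ifs <;> exact hc.uncolored _
      · unfold moveTo
        rw [if_neg (by omega), if_neg (by omega)]
        exact hc.fix q (by omega)
      · unfold moveTo
        split_ifs with h3 h4
        · exact hf.le
        · exact (hc.le _ (by omega)).trans (by omega)
        · rcases Nat.lt_or_ge m q with h5 | h5
          · rw [hc.fix q h5]
            exact hq
          · exact (hc.le _ h5).trans (by omega)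

/-- No entry lies below and to the right of an entry that lies below and to the right of an
entry. -/
def NoDescendingTriple {d : ℕ} (a : Config d) : Prop :=
  ∀ p q s, p < q → q < s → (a q).1 < (a p).1 → ¬ (a s).1 < (a q).1

/-- The values increase on the positions from `k` to `m`. -/
def IncreasesOn {d : ℕ} (k m : ℕ) (a : Config d) : Prop :=
  ∀ p q, k ≤ p → p < q → q ≤ m → (a p).1 < (a q).1

/-- The inserted entry is the maximum of the first `m + 2` positions, so it could only begin a
descending triple; the entries behind it increase by `hinc`. -/
theorem IsPrefixConfig.moveTo_noDescendingTriple {d m i : ℕ} {a : Config d}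
    (h : IsPrefixConfig m a) (hi : i ≤ m) (hinc : IncreasesOn i m a)
    (hno : NoDescendingTriple a) : NoDescendingTriple (moveTo (m + 1) i a) := by
  intro p q s hpq hqs h1 h2
  have hf := h.fix (m + 1) (by omega)
  have hmax : ∀ q, q ≤ m + 1 → (moveTo (m + 1) i a q).1 ≤ m + 1 := by
    intro q hq
    unfold moveTo
    split_ifs with h3 h4
    · exact hf.le
    · exact (h.le _ (by omega)).trans (by omega)
    · rcases Nat.lt_or_ge m q with h5 | h5
      · rw [h.fix q h5]
        exact hq
      · exact (h.le _ h5).trans (by omega)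
  have hfix : ∀ q, m + 1 < q → (moveTo (m + 1) i a q).1 = q := by
    intro q hq
    unfold moveTo
    rw [if_neg (by omega), if_neg (by omega)]
    exact h.fix q (by omega)
  have hself : (moveTo (m + 1) i a i).1 = m + 1 := by simp [moveTo, hf]
  have hne : ∀ q, q ≠ i → q ≤ m + 1 → moveTo (m + 1) i a q = a (source i q) := by
    intro q hq hqm
    unfold moveTo source
    split_ifs <;> first | rfl | omega
  have hs : s ≤ m + 1 := by
    by_contra hs
    rw [hfix s (by omega)] at h2
    rcases Nat.lt_or_ge (m + 1) q with h5 | h5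
    · rw [hfix q h5] at h2
      omega
    · have := hmax q h5
      omega
  have hqi : q ≠ i := by
    rintro rfl
    have := hmax p (by omega)
    omega
  have hsi : s ≠ i := by
    rintro rfl
    have := hmax q (by omega)
    omega
  rw [hne q hqi (by omega)] at h1 h2
  rw [hne s hsi hs] at h2
  have hqs' := source_lt_source hqi hsi hqs
  have hsm := source_lt (n := m + 2) (by omega) hsi (by omega)
  by_cases hpi : p = i
  · subst hpi
    have := hinc _ _ (le_source hpq) hqs' (by omega)
    omega
  · rw [hne p hpi (by omega)] at h1
    exact hno _ _ _ (source_lt_source hpi hqi hpq) hqs' h1 h2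

theorem IsPrefixConfig.increasesOn_succ {d k m : ℕ} {a : Config d} (h : IsPrefixConfig m a)
    (hinc : IncreasesOn k m a) : IncreasesOn k (m + 1) a := by
  intro p q hp hpq hq
  rcases hq.lt_or_eq with h1 | rfl
  · exact hinc p q hp hpq (by omega)
  · rw [h.fix (m + 1) (by omega)]
    have := h.le p (by omega)
    omega

theorem increasesOn_moveTo {d i k m : ℕ} {a : Config d} (hik : i < k) (hinc : IncreasesOn i m a) :
    IncreasesOn k (m + 1) (moveTo (m + 1) i a) := by
  intro p q hp hpq hq
  unfold moveTo
  rw [if_neg (by omega), if_pos (by omega), if_neg (by omega), if_pos (by omega)]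
  exact hinc _ _ (by omega) (by omega) (by omega)

theorem config_of_mem_goodWords {d n m k : ℕ} [NeZero d] (hm : m + 1 ≤ n) {u : GWord n}
    (hu : u ∈ goodWords n m k) :
    NoDescendingTriple (config d u) ∧ IncreasesOn k m (config d u) := by
  induction m generalizing k u with
  | zero =>
    simp only [goodWords, Finset.mem_singleton] at hu
    subst hu
    simp only [config, run_nil, NoDescendingTriple, IncreasesOn, initConfig]
    constructor <;> intros <;> omega
  | succ m ih =>
    rcases mem_goodWords_succ.1 hu with hu | ⟨i, v, h1, h2, h3, rfl⟩
    · obtain ⟨h4, h5⟩ := ih (by omega) hu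
      have hc := ((isPrefixUpTo_of_mem_goodWords hu).isTight (d := d) (by omega)).2
      exact ⟨h4, hc.increasesOn_succ h5⟩
    · obtain ⟨h4, h5⟩ := ih (by omega) h3
      have hc := ((isPrefixUpTo_of_mem_goodWords h3).isTight (d := d) (by omega)).2
      rw [config_descWord hm (by omega)]
      exact ⟨hc.moveTo_noDescendingTriple h2 h5 h4, increasesOn_moveTo h1 h5⟩

theorem increasesOn_of_mem_nearlyGoodWords {d n k e : ℕ} [NeZero d] (h : k + e + 1 ≤ n)
    {u : GWord n} (hu : u ∈ nearlyGoodWords n k e) : IncreasesOn k (k + e - 1) (config d u) := by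
  induction e generalizing u with
  -- The interval from `k` to `k - 1` has no two positions, also for `k = 0`, where the subtraction
  -- is truncated.
  | zero => intro p q _ _ _; omega
  | succ e ih =>
    rcases mem_nearlyGoodWords_succ.1 hu with hu | ⟨v, hv, rfl⟩
    · intro p q hp hpq hq
      exact (config_of_mem_goodWords (by omega) hu).2 p q hp hpq (by omega)
    · have hv' := nearlyGoodWords_subset _ _ _ hv
      have hc := ((isPrefixUpTo_of_mem_goodWords hv').isTight (d := d) (by omega)).2
      rw [config_descWord (by omega) (by omega)]
      intro p q hp hpq hq
      have hself : (moveTo (k + e + 1) (k + e) (config d v) (k + e)).1 = k + e + 1 := by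
        simp [moveTo, hc.fix (k + e + 1) (by omega)]
      have hlt : ∀ q, q < k + e → moveTo (k + e + 1) (k + e) (config d v) q = config d v q := by
        intro q hq
        unfold moveTo
        rw [if_neg (by omega), if_neg (by omega)]
      rw [hlt p (by omega)]
      rcases Nat.lt_or_ge q (k + e) with h1 | h1
      · rw [hlt q h1]
        exact ih (by omega) hv p q hp hpq (by omega)
      · rw [show q = k + e by omega, hself]
        have := hc.le p (by omega)
        omega

/-! ### Pattern avoidance for canonical words -/

theorem avoidsPatterns_of_uncolored {d n : ℕ} {a : Config d} (h : ∀ q, (a q).2 = 0)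
    (hno : NoDescendingTriple a) : AvoidsPatterns n a := by
  refine ⟨fun p q s hpq hqs _ h1 h2 => ?_, fun p _ _ _ h1 => absurd (h p) h1,
    fun p _ _ _ _ _ _ h1 => absurd (h p) h1, fun _ _ s _ _ _ _ _ _ h1 => absurd (h s) h1⟩
  have := hno p q s hpq hqs
  have := h p
  have := h q
  have := h s
  unfold EntryGT at h1 h2
  grind

/-- Only position `j` is colored, so the conditions on two colored entries are void. The colored
entry can only begin a descending triple, which `hinc` excludes. An inversion above its value would
be a descending triple of `a` that ends in the last position. -/
theorem avoidsPatterns_colorMove {d n t j : ℕ} {a : Config d} (h : ∀ q, (a q).2 = 0)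
    (hno : NoDescendingTriple a) (hj : j + 1 ≤ n) (ht : (t : ZMod d) ≠ 0)
    (hinc : IncreasesOn j (n - 2) a) : AvoidsPatterns n (colorMove n t j a) := by
  have hself := colorMove_self (n := n) (t := t) (j := j) a
  have hne : ∀ q, q ≠ j → q < n → colorMove n t j a q = a (source j q) := fun q h1 h2 =>
    colorMove_of_ne a hj h1 h2
  generalize colorMove n t j a = b at *
  have hcol : ∀ q, q < n → (b q).2 ≠ 0 → q = j := by
    intro q hq h1
    by_contra h2
    rw [hne q h2 hq] at h1
    exact h1 (h _)
  constructor
  · intro p q s hpq hqs hs h1 h2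
    have hqj : q ≠ j := by
      rintro rfl
      have := h (source q p)
      rw [hself, hne p (by omega) (by omega)] at h1
      unfold EntryGT at h1
      grind
    have hsj : s ≠ j := by
      rintro rfl
      have := h (source s q)
      rw [hself, hne q (by omega) (by omega)] at h2
      unfold EntryGT at h2
      grind
    have e1 := h (source j q)
    have e2 := h (source j s)
    have e3 := h (source j p)
    have e4 := source_lt_source hqj hsj hqs
    have e5 := source_lt hj hsj hs
    rw [hne q hqj (by omega)] at h1 h2
    rw [hne s hsj hs] at h2
    by_cases hpj : p = j
    · subst hpj
      have := hinc _ _ (le_source hpq) e4 (by omega)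
      unfold EntryGT at h2
      grind
    · rw [hne p hpj (by omega)] at h1
      have := hno _ _ _ (source_lt_source hpj hqj hpq) e4
      unfold EntryGT at h1 h2
      grind
  · intro p q hpq hq h1 h2
    have := hcol p (by omega) h1
    have := hcol q hq h2
    omega
  · intro p q s hpq hq _ _ h1 h2
    have := hcol p (by omega) h1
    have := hcol q hq h2
    omega
  · intro p q s hpq hq hs h1 h2 h3 h4 h5
    obtain rfl := hcol s hs h4
    have hps : p ≠ s := by
      rintro rfl
      exact h4 h1
    have hqs : q ≠ s := by
      rintro rfl
      exact h4 h2
    rw [hne q hqs hq, hne p hps (by omega)] at h3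
    rw [hself, hne q hqs hq] at h5
    exact hno _ _ _ (source_lt_source hps hqs hpq) (source_lt hj hqs hq) h3 h5

/-- The configurations of fully commutative elements between the blocks of a suffix; the last
block ends at position `j`. -/
structure IsSuffixConfig {d : ℕ} (n j : ℕ) (a : Config d) : Prop where
  avoids : AvoidsPatterns n a
  uncolored : ∀ q, j < q → q < n → (a q).2 = 0
  colored : ∃ p, p ≤ j ∧ (a p).2 ≠ 0
  lt : ∀ p s q, p < s → s < n → q < n → (a p).2 ≠ 0 → (a s).2 = 0 → (a q).2 ≠ 0 →
    (a s).1 < (a q).1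

/-- The increase now has to reach position `n - 1`: the entry colored there must exceed the
uncolored entries that end up to its right. -/
theorem isSuffixConfig_colorMove {d n t j : ℕ} {a : Config d} (h : ∀ q, (a q).2 = 0)
    (hno : NoDescendingTriple a) (hj : j + 1 ≤ n) (ht : (t : ZMod d) ≠ 0)
    (hinc : IncreasesOn j (n - 1) a) : IsSuffixConfig n j (colorMove n t j a) := by
  have havoid := avoidsPatterns_colorMove h hno hj ht
    fun p q h1 h2 h3 => hinc p q h1 h2 (by omega)
  have hself := colorMove_self (n := n) (t := t) (j := j) a
  have hne : ∀ q, q ≠ j → q < n → colorMove n t j a q = a (source j q) := fun q h1 h2 =>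
    colorMove_of_ne a hj h1 h2
  generalize colorMove n t j a = b at *
  have hcol : ∀ q, q < n → (b q).2 ≠ 0 → q = j := by
    intro q hq h1
    by_contra h2
    rw [hne q h2 hq] at h1
    exact h1 (h _)
  refine ⟨havoid, fun q h1 h2 => ?_, ⟨j, le_rfl, by rw [hself]; exact ht⟩,
    fun p s q hps hs hq h1 h2 h3 => ?_⟩
  · rw [hne q (by omega) h2]
    exact h _
  · obtain rfl := hcol p (by omega) h1
    obtain rfl := hcol q hq h3
    rw [hself, hne s (by omega) hs]
    exact hinc _ _ (le_source hps) (source_lt hj (by omega) hs) le_rfl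

/-- The last entry is uncolored and lies below every colored value, by `lt`. It also lies above each
other uncolored value to the right of a colored entry, as otherwise these entries form a descending
triple. Coloring and moving it therefore preserves the invariant. -/
theorem IsSuffixConfig.next {d n t i j : ℕ} {a : Config d} (ha : IsSuffixConfig n i a)
    (hv : Valid n a) (hij : i < j) (hj : j + 1 ≤ n) (ht : (t : ZMod d) ≠ 0) :
    IsSuffixConfig n j (colorMove n t j a) := by
  have hself := colorMove_self (n := n) (t := t) (j := j) a
  have hne : ∀ q, q ≠ j → q < n → colorMove n t j a q = a (source j q) := fun q h1 h2 =>
    colorMove_of_ne a hj h1 h2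
  generalize colorMove n t j a = b at *
  obtain ⟨r, hr, hcr⟩ := ha.colored
  have hlast := ha.uncolored (n - 1) (by omega) (by omega)
  have hmax : ∀ p s, p < s → s < n - 1 → (a p).2 ≠ 0 → (a s).2 = 0 →
      (a s).1 < (a (n - 1)).1 := by
    intro p s hps hs h1 h2
    have e1 := ha.avoids.no_descending p s (n - 1) hps hs (by omega) (Or.inl ⟨h1, h2⟩)
    have e2 : (a s).1 ≠ (a (n - 1)).1 := fun hh => by
      have := hv.inj hh
      omega
    unfold EntryGT at e1
    grind
  have hmin : ∀ q, q < n → (a q).2 ≠ 0 → (a (n - 1)).1 < (a q).1 := fun q hq h1 =>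
    ha.lt r (n - 1) q (by omega) (by omega) hq hcr hlast h1
  have hunc : ∀ q, j < q → q < n → (b q).2 = 0 := by
    intro q h1 h2
    rw [hne q (by omega) h2]
    exact ha.uncolored _ (by have := le_source h1; omega)
      (by have := source_lt hj (by omega) h2; omega)
  have hsource : ∀ q, q ≠ j → q < n → source j q < n := fun q h1 h2 => by
    have := source_lt hj h1 h2
    omega
  have hlt : ∀ p s q, p < s → s < n → q < n → (b p).2 ≠ 0 → (b s).2 = 0 → (b q).2 ≠ 0 →
      (b s).1 < (b q).1 := by
    intro p s q hps hs hq h1 h2 h3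
    have hsj : s ≠ j := by
      rintro rfl
      rw [hself] at h2
      exact ht h2
    have hs' := source_lt hj hsj hs
    rw [hne s hsj hs] at h2 ⊢
    -- If the colored entry before `s` is the new one, the old colored entry `r`, which lies further
    -- left, takes its role in `a`.
    obtain ⟨p', hp', hcp'⟩ : ∃ p', p' < source j s ∧ (a p').2 ≠ 0 := by
      by_cases hpj : p = j
      · subst hpj
        exact ⟨r, by have := le_source hps; omega, hcr⟩
      · rw [hne p hpj (by omega)] at h1
        exact ⟨_, source_lt_source hpj hsj hps, h1⟩
    by_cases hqj : q = j
    · subst hqj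
      rw [hself]
      exact hmax p' _ hp' hs' hcp' h2
    · rw [hne q hqj hq] at h3 ⊢
      exact ha.lt p' _ _ hp' (by omega) (hsource q hqj hq) hcp' h2 h3
  refine ⟨⟨?_, ?_, ?_, ?_⟩, hunc, ⟨j, le_rfl, by rw [hself]; exact ht⟩, hlt⟩
  · intro p q s hpq hqs hs h1 h2
    have hqj : q ≠ j := by
      rintro rfl
      have := hmin (source q p) (hsource p (by omega) (by omega))
      rw [hself, hne p (by omega) (by omega)] at h1
      unfold EntryGT at h1
      grind
    have hsj : s ≠ j := by
      rintro rfl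
      have := hmin (source s q) (hsource q (by omega) (by omega))
      rw [hself, hne q (by omega) (by omega)] at h2
      unfold EntryGT at h2
      grind
    have e4 := source_lt_source hqj hsj hqs
    by_cases hpj : p = j
    · subst hpj
      have e5 := hunc q hpq (by omega)
      rw [hne q hqj (by omega)] at h2 e5
      rw [hne s hsj hs] at h2
      exact ha.avoids.no_descending r _ _ (by have := le_source hpq; omega) e4
        (hsource s hsj hs) (Or.inl ⟨hcr, e5⟩) h2
    · rw [hne p hpj (by omega), hne q hqj (by omega)] at h1
      rw [hne q hqj (by omega), hne s hsj hs] at h2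
      exact ha.avoids.no_descending _ _ _ (source_lt_source hpj hqj hpq) e4 (hsource s hsj hs) h1 h2
  · intro p q hpq hq h1 h2
    have hpj : p ≠ j := by
      rintro rfl
      exact h2 (hunc q hpq hq)
    rw [hne p hpj (by omega)] at h1 ⊢
    by_cases hqj : q = j
    · subst hqj
      rw [hself]
      exact hmin _ (hsource p hpj (by omega)) h1
    · rw [hne q hqj hq] at h2 ⊢
      exact ha.avoids.colored_lt _ _ (source_lt_source hpj hqj hpq) (hsource q hqj hq) h1 h2
  · intro p q s _ hq hps hs h1 h2 h3
    exact hlt p s q hps hs hq h1 h3 h2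
  · intro p q s hpq hq hs h1 h2 h3 h4 h5
    have hpj : p ≠ j := by
      rintro rfl
      rw [hself] at h1
      exact ht h1
    have hqj : q ≠ j := by
      rintro rfl
      rw [hself] at h2
      exact ht h2
    rw [hne p hpj (by omega)] at h1 h3
    rw [hne q hqj hq] at h2 h3 h5
    have e1 := source_lt_source hpj hqj hpq
    by_cases hsj : s = j
    · subst hsj
      rw [hself] at h5
      exact ha.avoids.no_descending _ _ (n - 1) e1 (source_lt hj hqj hq) (by omega)
        (Or.inr (Or.inl ⟨h1, h2, h3⟩)) (Or.inr (Or.inl ⟨h2, hlast, h5⟩))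
    · rw [hne s hsj hs] at h4 h5
      exact ha.avoids.inverted_lt _ _ _ e1 (hsource q hqj hq) (hsource s hsj hs) h1 h2 h3 h4 h5

theorem suffixWord_cons (n : ℕ) (p : ℕ × ℕ) (L : List (ℕ × ℕ)) :
    suffixWord n (p :: L) = blockWord n p.1 p.2 ++ suffixWord n L := by
  simp [suffixWord]

theorem suffixWord_singleton (n t j : ℕ) : suffixWord n [(t, j)] = blockWord n t j := by
  simp [suffixWord]

theorem isSuffixData_singleton {d n t j : ℕ} (h1 : 1 ≤ t) (h2 : t < d) (h3 : 1 ≤ j)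
    (h4 : j ≤ n) : IsSuffixData d n [(t, j)] := by
  simp [IsSuffixData, h1, h2, h3, h4]

theorem IsSuffixData.tail {d n : ℕ} {p : ℕ × ℕ} {L : List (ℕ × ℕ)}
    (h : IsSuffixData d n (p :: L)) : IsSuffixData d n L :=
  ⟨(List.pairwise_cons.1 h.1).2, fun q hq => h.2 q (List.mem_cons_of_mem _ hq)⟩

/-- A block that ends at `j` leaves only uncolored entries behind `j`, and later blocks end strictly
further right. -/
theorem IsTight.suffixWord {d n : ℕ} [NeZero d] {L : List (ℕ × ℕ)} (hL : IsSuffixData d n L)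
    {u : GWord n} (hu : IsTight d u)
    (h0 : ∀ p ∈ L, ∀ q, p.2 ≤ q + 1 → q < n → (config d u q).2 = 0) :
    IsTight d (u ++ suffixWord n L) := by
  induction L generalizing u with
  | nil => simpa [_root_.suffixWord]
  | cons p L ih =>
    obtain ⟨t, j⟩ := p
    obtain ⟨h1, h2, h3, h4⟩ := hL.2 (t, j) (by simp)
    simp only at h1 h2 h3 h4
    obtain ⟨j, rfl⟩ : ∃ i, j = i + 1 := ⟨j - 1, by omega⟩
    have h0' := h0 (t, j + 1) (by simp)
    simp only at h0'
    rw [suffixWord_cons, ← List.append_assoc]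
    refine ih hL.tail (hu.blockWord h4 h1 h2 fun q hq hqn => h0' q (by omega) hqn) ?_
    intro p hp q hpq hqn
    have hlt := (List.pairwise_cons.1 hL.1).1 p hp
    simp only at hlt
    rw [config_blockWord h4 (h0' _ (by omega) (by omega)), colorMove_of_gt _ (by omega) hqn]
    exact h0' _ (by omega) (by omega)

theorem isTight_canonicalWord {d n : ℕ} [NeZero d] (hn : 1 ≤ n) {u : GWord n}
    (hu : u ∈ prefixes n) {L : List (ℕ × ℕ)} (hL : IsSuffixData d n L) :
    IsTight d (u ++ suffixWord n L) := by
  obtain ⟨h1, h2⟩ := IsPrefixUpTo.isTight (d := d) (m := n - 1) (by omega) hu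
  exact h1.suffixWord hL fun _ _ q _ _ => h2.uncolored q

theorem IsSuffixConfig.suffixWord {d n : ℕ} [NeZero d] {L : List (ℕ × ℕ)}
    (hL : IsSuffixData d n L) {u : GWord n} {i : ℕ} (hi : ∀ p ∈ L, i + 1 < p.2)
    (hu : IsSuffixConfig n i (config d u)) :
    AvoidsPatterns n (config d (u ++ suffixWord n L)) := by
  induction L generalizing u i with
  | nil => simpa [_root_.suffixWord] using hu.avoids
  | cons p L ih =>
    obtain ⟨t, j⟩ := p
    obtain ⟨h1, h2, h3, h4⟩ := hL.2 (t, j) (by simp)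
    have hij := hi (t, j) (by simp)
    simp only at h1 h2 h3 h4 hij
    obtain ⟨j, rfl⟩ : ∃ i, j = i + 1 := ⟨j - 1, by omega⟩
    rw [suffixWord_cons, ← List.append_assoc]
    refine ih hL.tail (i := j) (fun p hp => (List.pairwise_cons.1 hL.1).1 p hp) ?_
    simp only
    rw [config_blockWord h4 (hu.uncolored _ (by omega) (by omega))]
    exact hu.next (valid_config d u) (by omega) h4 (natCast_ne_zero_of_lt h1 h2)

/-! ### Counting the collections -/

/-- Canonical words are tight, so patterns certify the prefixes in `S` and braids exclude the rest.
A prefix that is not good already has a braid of its own. -/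
theorem collection_eq {d n : ℕ} [NeZero d] (hn : 1 ≤ n) {L : List (ℕ × ℕ)}
    (hL : IsSuffixData d n L) (S : Finset (GWord n)) (hS : S ⊆ goodWords n (n - 1) (n - 1))
    (hpos : ∀ u ∈ S, AvoidsPatterns n (config d (u ++ suffixWord n L)))
    (hneg : ∀ u ∈ goodWords n (n - 1) (n - 1), u ∉ S →
      HasBraid (u ++ suffixWord n L) ∨ HasBraidLast (u ++ suffixWord n L)) :
    collection d n (suffixWord n L) = ↑(S.image (· ++ suffixWord n L)) := by
  ext w
  simp only [Finset.coe_image, Set.mem_image, Finset.mem_coe]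
  constructor
  · rintro ⟨-, ⟨u, hu, rfl⟩, hfc⟩
    have ht := isTight_canonicalWord hn hu hL
    refine ⟨u, ?_, rfl⟩
    by_contra huS
    rcases mem_goodWords_or_hasBraid (by omega) hu with h | h
    · rcases hneg u h huS with h | h
      · exact h.not_isFullyCommutative ht hfc
      · exact h.not_isFullyCommutative ht hfc
    · exact (h.append _).not_isFullyCommutative ht hfc
  · rintro ⟨u, hu, rfl⟩
    have hup : u ∈ prefixes n := isPrefixUpTo_of_mem_goodWords (hS hu)
    exact ⟨⟨u, hup, _, ⟨L, hL, rfl⟩, rfl⟩, ⟨u, hup, rfl⟩,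
      isFullyCommutative_of_avoidsPatterns (isTight_canonicalWord hn hup hL) (hpos u hu)⟩

theorem finite_ncard_image {n : ℕ} (S : Finset (GWord n)) (v : GWord n) :
    (↑(S.image (· ++ v)) : Set (GWord n)).Finite ∧
      (↑(S.image (· ++ v)) : Set (GWord n)).ncard = S.card := by
  refine ⟨Finset.finite_toSet _, ?_⟩
  rw [Set.ncard_coe_finset, Finset.card_image_of_injective _ (List.append_left_injective v)]

theorem ncard_collection_nil {d n : ℕ} [NeZero d] (hn : 1 ≤ n) :
    (collection d n []).Finite ∧ ((collection d n []).ncard : ℚ) = catalanTriangle n n := by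
  have hnil : suffixWord n [] = [] := rfl
  rw [← hnil, collection_eq hn (by simp [IsSuffixData]) (goodWords n (n - 1) (n - 1)) subset_rfl
    (fun u hu => ?_) fun u hu hu' => absurd hu hu', (finite_ncard_image _ _).2,
    card_goodWords (by omega)]
  · refine ⟨(finite_ncard_image _ _).1, ?_⟩
    obtain ⟨m, rfl⟩ : ∃ m, n = m + 1 := ⟨n - 1, by omega⟩
    rw [catalanTriangle_self]
    simp
  · rw [hnil, List.append_nil]
    exact avoidsPatterns_of_uncolored
      ((isPrefixUpTo_of_mem_goodWords hu).isTight (d := d) (by omega)).2.uncolored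
      (config_of_mem_goodWords (by omega) hu).1

theorem ncard_collection_last {d n t : ℕ} [NeZero d] (hn : 1 ≤ n) (ht : 1 ≤ t) (htd : t < d) :
    (collection d n (blockWord n t n)).Finite ∧
      ((collection d n (blockWord n t n)).ncard : ℚ) = catalanTriangle n (n - 1) := by
  rw [← suffixWord_singleton, collection_eq hn (isSuffixData_singleton ht htd hn le_rfl)
    (goodWords n (n - 1) (n - 1)) subset_rfl (fun u hu => ?_) fun u hu hu' => absurd hu hu',
    (finite_ncard_image _ _).2, card_goodWords (by omega)]
  · refine ⟨(finite_ncard_image _ _).1, ?_⟩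
    rw [min_self, Nat.sub_add_cancel hn]
  · have hc := ((isPrefixUpTo_of_mem_goodWords hu).isTight (d := d) (by omega)).2
    have := config_blockWord (d := d) (t := t) (j := n - 1) (by omega) (hc.uncolored (n - 1))
    rw [Nat.sub_add_cancel hn] at this
    rw [suffixWord_singleton, this]
    exact avoidsPatterns_colorMove hc.uncolored (config_of_mem_goodWords (by omega) hu).1
      (by omega) (natCast_ne_zero_of_lt ht htd) fun p q h1 h2 h3 => by omega

theorem ncard_collection_block {d n t k : ℕ} [NeZero d] (ht : 1 ≤ t) (htd : t < d) (hk : 1 ≤ k)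
    (hkn : k + 1 ≤ n) :
    (collection d n (blockWord n t k)).Finite ∧
      ((collection d n (blockWord n t k)).ncard : ℚ) = catalanTriangle n k := by
  obtain ⟨k, rfl⟩ : ∃ k', k = k' + 1 := ⟨k - 1, by omega⟩
  have he : k + (n - 1 - k) = n - 1 := by omega
  have hsub : nearlyGoodWords n k (n - 1 - k) ⊆ goodWords n (n - 1) (n - 1) := by
    have := nearlyGoodWords_subset n k (n - 1 - k)
    rwa [he] at this
  rw [← suffixWord_singleton, collection_eq (by omega)
    (isSuffixData_singleton ht htd hk (by omega)) (nearlyGoodWords n k (n - 1 - k)) hsub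
    (fun u hu => ?_) (fun u hu hu' => ?_), (finite_ncard_image _ _).2,
    card_nearlyGoodWords (by omega)]
  · refine ⟨(finite_ncard_image _ _).1, ?_⟩
    rw [he, Nat.sub_add_cancel (by omega)]
  · have hc := ((isPrefixUpTo_of_mem_goodWords (hsub hu)).isTight (d := d) (by omega)).2
    rw [suffixWord_singleton, config_blockWord (by omega) (hc.uncolored (n - 1))]
    refine avoidsPatterns_colorMove hc.uncolored (config_of_mem_goodWords (by omega) (hsub hu)).1
      (by omega) (natCast_ne_zero_of_lt ht htd) ?_
    have := increasesOn_of_mem_nearlyGoodWords (d := d) (by omega) hu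
    rwa [he] at this
  · left
    have hl : letter (⟨n - 1, by omega⟩ : Fin n) = n := by simp only [letter]; omega
    -- Here `l` is at most `n - 2`, so it commutes with `s_n` too and meets `l + 1` and `l` in the
    -- block.
    obtain ⟨x, l, y, rfl, h1, h2, h3⟩ := exists_of_not_mem_nearlyGoodWords (by omega)
      (by rwa [he]) hu'
    rw [suffixWord_singleton, blockWord_eq _ hl, ← List.append_assoc, List.append_assoc _ y]
    refine hasBraid_descWord x _ l (by omega) (by omega) h1 fun i hi => ?_
    rw [List.mem_append] at hi
    rcases hi with hi | hi
    · exact h3 i hi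
    · rw [List.eq_of_mem_replicate hi, hl]
      omega

theorem ncard_collection_blocks {d n t k : ℕ} [NeZero d] (hkn : k + 2 ≤ n)
    {L : List (ℕ × ℕ)} (hne : L ≠ []) (hL : IsSuffixData d n ((t, k + 1) :: L)) :
    (collection d n (suffixWord n ((t, k + 1) :: L))).Finite ∧
      ((collection d n (suffixWord n ((t, k + 1) :: L))).ncard : ℚ) = catalanTriangle n k := by
  obtain ⟨ht, htd, -, -⟩ := hL.2 (t, k + 1) (by simp)
  simp only at ht htd
  have hsub : goodWords n (n - 1) k ⊆ goodWords n (n - 1) (n - 1) := goodWords_mono (by omega)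
  rw [collection_eq (by omega) hL (goodWords n (n - 1) k) hsub (fun u hu => ?_)
    (fun u hu hu' => ?_), (finite_ncard_image _ _).2, card_goodWords (by omega)]
  · refine ⟨(finite_ncard_image _ _).1, ?_⟩
    rw [Nat.sub_add_cancel (by omega), min_eq_left (by omega)]
  · have hc := ((isPrefixUpTo_of_mem_goodWords hu).isTight (d := d) (by omega)).2
    obtain ⟨h1, h2⟩ := config_of_mem_goodWords (d := d) (by omega) hu
    rw [suffixWord_cons, ← List.append_assoc]
    refine IsSuffixConfig.suffixWord hL.tail (i := k)
      (fun p hp => (List.pairwise_cons.1 hL.1).1 p hp) ?_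
    simp only
    rw [config_blockWord (by omega) (hc.uncolored (n - 1))]
    exact isSuffixConfig_colorMove hc.uncolored h1 (by omega) (natCast_ne_zero_of_lt ht htd) h2
  · have hl : letter (⟨n - 1, by omega⟩ : Fin n) = n := by simp only [letter]; omega
    obtain ⟨x, l, rfl, h1, h2⟩ := exists_concat_of_not_mem_goodWords (by omega) hu hu'
    rw [suffixWord_cons, ← List.append_assoc]
    simp only
    rw [blockWord_eq _ hl]
    -- A last letter below `n - 1` forms a braid with the first block. The letter `n - 1` forms
    -- `s_{n-1} s_n^t s_{n-1}` with it, and the next block, present as `L` is nonempty, supplies the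
    -- final `s_n`.
    rcases h2.lt_or_eq with h3 | h3
    · left
      rw [← List.append_assoc]
      refine (hasBraid_descWord x _ l (by omega) h3 h1 fun i hi => ?_).append _
      rw [List.eq_of_mem_replicate hi, hl]
      omega
    · right
      obtain ⟨⟨t', j'⟩, L, rfl⟩ := List.exists_cons_of_ne_nil hne
      obtain ⟨ht', -⟩ := hL.tail.2 (t', j') (by simp)
      simp only at ht'
      obtain ⟨t', rfl⟩ : ∃ s, t' = s + 1 := ⟨t' - 1, by omega⟩
      have hd : descWord n (n - 1) (k + 1) = l :: descWord n (n - 2) (k + 1) := by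
        have := descWord_cons (i := n - 2) (j := k + 1) l (by omega) (by omega)
        rwa [show n - 2 + 1 = n - 1 by omega] at this
      rw [suffixWord_cons, blockWord_eq _ hl, List.replicate_succ, hd]
      refine ⟨x, descWord n (n - 2) (k + 1), List.replicate t' ⟨n - 1, by omega⟩ ++
        descWord n (n - 1) j' ++ suffixWord n L, t, l, ⟨n - 1, by omega⟩, by simp,
        fun i hi => ?_, ?_, ?_⟩
      · rw [mem_descWord] at hi
        simp only [letter] at hi
        exact Or.inr (by simp only; omega)
      · simp only [letter] at h3
        exact h3.symm
      · exact hl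

theorem theorem4p9 (d n k : ℕ) (hd : 1 ≤ d) (hn : 3 ≤ n) (hk : k ≤ n) :
    ∀ c ∈ packet d n k, c.Finite ∧ (c.ncard : ℚ) = catalanTriangle n k := by
  have : NeZero d := ⟨by omega⟩
  rintro _ ⟨v, hv, rfl⟩
  rcases hv with ⟨rfl, rfl⟩ | ⟨rfl, t, h1, h2, rfl | rfl⟩ | ⟨h1, h2, t, h3, h4, rfl⟩ |
    ⟨h1, t, L, h2, h3, rfl⟩
  · exact ncard_collection_nil (by omega)
  · exact ncard_collection_last (by omega) h1 h2
  · exact ncard_collection_block h1 h2 (by omega) (by omega)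
  · exact ncard_collection_block h3 h4 h1 (by omega)
  · exact ncard_collection_blocks h1 h2 h3
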